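/- Let $\mathrm{pr}\colon\mathbf R^2\to T^2=(\mathbf R/2\pi\mathbf Z)^2$ be the standard projection, let $E$ be a smooth oriented real vector bundle of rank $4$ over $T^2$ with a positive-definite metric $h$, and let $\nabla$ be a connection of $E$ with $\nabla h=0$. For $\varepsilon\in\{+,-\}$ let $\bigwedge^2_\varepsilon E$ be the oriented rank $3$ subbundle of $\bigwedge^2E$ with the positive local orthonormal frames $\frac1{\sqrt2}(e_1\wedge e_2+\varepsilon e_3\wedge e_4)$, $\frac1{\sqrt2}(e_1\wedge e_3+\varepsilon e_4\wedge e_2)$, $\frac1{\sqrt2}(e_1\wedge e_4+\varepsilon e_2\wedge e_3)$, where $(e_1,e_2,e_3,e_4)$ are the positive local orthonormal frames of $E$; let $\hat E_\varepsilon$ be its unit sphere bundle, and let $\hat\nabla$ be the connection of $\bigwedge^2E$ induced by $\nabla$. *Topological holonomy group.* Let $(\omega_1,\omega_2,\omega_3)$ be a positive orthonormal basis of the fibre of $\bigwedge^2_\varepsilon E$ at $\mathrm{pr}(0,0)$, and let $\Omega_{i,x}$, $\Omega_{i,y}$ be the $\hat\nabla$-horizontal sections of $\hat E_\varepsilon$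 along the axes $x\mapsto\mathrm{pr}(x,0)$, $y\mapsto\mathrm{pr}(0,y)$ with value $\omega_i$ at $0$. There are $C_{\varepsilon,1},C_{\varepsilon,2}\in SO(3)$ with $(\Omega_{i,x}(a+2\pi))_i=(\Omega_{i,x}(a))_i\,C_{\varepsilon,1}$ and $(\Omega_{i,y}(b+2\pi))_i=(\Omega_{i,y}(b))_i\,C_{\varepsilon,2}$ for all $a,b\in\mathbf R$. The topological holonomy group $G_{\hat\nabla,\varepsilon}$ is the subgroup of $SO(3)$ generated by $C_{\varepsilon,1}$, $C_{\varepsilon,2}$; it is determined up to conjugation in $SO(3)$. *Complexity.* A normal polygonal curve is an oriented polygonal curve in $\mathbf R^2$ from $(0,0)$, each of whose line segments lies in a horizontal or vertical line and has end points with the same image under $\mathrm{pr}$. For $\omega$ in the fibre of $\hat E_\varepsilon$ at $\mathrm{pr}(0,0)$, let $X(\omega)$ be the set of all elements obtained from $\omega$ by $\hat\nabla$-parallel transport along normal polygonal curves. The horizontality in $\hat E_\varepsilon$ has infinite complexity if $X(\omega)$ is infinite for some such $\omega$. *The group $G$.* Let $G_0$ be a finite non-cyclic subgroup of $SO(3)$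 generated by two elements $C_1,C_2$, let $\theta_1,\theta_2\in(0,2\pi)$ be angles of rotation by $C_1,C_2$, and let $\phi\in(0,\pi/2]$ be the angle between the eigendirections of $C_1,C_2$ corresponding to the eigenvalue $1$. Let $(\theta_1',\theta_2')$ be $(\theta_1/2,\theta_2)$ or $(\theta_1,\theta_2/2)$, let $C_1',C_2'\in SO(3)$ be rotations with angles of rotation $\theta_1',\theta_2'$ such that $\phi$ is the angle between their eigendirections corresponding to the eigenvalue $1$, and let $G$ be the subgroup of $SO(3)$ generated by $C_1',C_2'$. **Proposition.** Suppose that $G_{\hat\nabla,\varepsilon}$ is isomorphic to such a group $G$ and that the horizontality in $\hat E_\varepsilon$ with respect to $\hat\nabla$ has infinite complexity. Then $G_{\hat\nabla,\varepsilon}$ contains two elements $\hat C_1,\hat C_2$ such that - (A) $\hat C_k^2$ is not the identity matrix, for $k=1$ and for $k=2$; - (B) an eigenvector of $\hat C_1$ and an eigenvector of $\hat C_2$, both corresponding to the eigenvalue $1$, are linearly independent; - (C) for $k=1$ or $k=2$, an eigenvalue of $\hat C_k$ other than $1$ is $\exp(\sqrt{-1}\,\psi\pi)$ for an irrational real number $\psi$.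 -/

import Mathlib

open Bundle Filter Set
open scoped Manifold ContDiff Topology

noncomputable section

namespace TopHolonomy

/-! ### The torus -/

/-- The torus `T² = S¹ × S¹`; the circle `ℝ / 2πℤ` is the unit circle through `t ↦ exp (i t)`. -/
abbrev Torus : Type := Circle × Circle

/-- The model with corners of the smooth surface `T²`. -/
abbrev torusModel :
    ModelWithCorners ℝ (EuclideanSpace ℝ (Fin 1) × EuclideanSpace ℝ (Fin 1))
      (ModelProd (EuclideanSpace ℝ (Fin 1)) (EuclideanSpace ℝ (Fin 1))) :=
  (𝓡 1).prod (𝓡 1)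

/-- The model fibre of a real vector bundle of rank 4. -/
abbrev R4 : Type := EuclideanSpace ℝ (Fin 4)

/-- The standard projection `pr : ℝ² → T²`. -/
def pr (p : ℝ × ℝ) : Torus := (Circle.exp p.1, Circle.exp p.2)

/-- The image in `T²` of the horizontal axis `{(t, 0)}`. -/
def lineX (t : ℝ) : Torus := pr (t, 0)

/-- The image in `T²` of the vertical axis `{(0, t)}`. -/
def lineY (t : ℝ) : Torus := pr (0, t)

/-- The image in `T²` of the line segment from `v` to `w`, run through for `t ∈ [0, 1]`. -/
def segmentCurve (v w : ℝ × ℝ) (t : ℝ) : Torus := pr (v + t • (w - v))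

/-- The velocity vector of a curve in `T²`. -/
def velocity (c : ℝ → Torus) (t : ℝ) : TangentSpace torusModel (c t) :=
  mfderiv 𝓘(ℝ, ℝ) torusModel c t (1 : ℝ)

/-! ### 2-vectors of a Euclidean vector space of dimension 4 -/

section Fibre

variable {W : Type*} [NormedAddCommGroup W] [InnerProductSpace ℝ W]

/-- The 2-vector `u ∧ v`. -/
def wedge (u v : W) : ⋀[ℝ]^2 W := exteriorPower.ιMulti ℝ 2 ![u, v]

/-- The metric `ĥ` on 2-vectors induced by the inner product:
`ĥ (u ∧ v) (u' ∧ v') = ⟨u, u'⟩ ⟨v, v'⟩ - ⟨u, v'⟩ ⟨v, u'⟩`, see `hatMetric_wedge`. -/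
def hatMetric : ⋀[ℝ]^2 W →ₗ[ℝ] ⋀[ℝ]^2 W →ₗ[ℝ] ℝ :=
  exteriorPower.pairingDual ℝ W 2 ∘ₗ exteriorPower.map 2 (innerₗ W)

theorem hatMetric_wedge (u v u' v' : W) :
    hatMetric (wedge u v) (wedge u' v') =
      inner ℝ u u' * inner ℝ v v' - inner ℝ u v' * inner ℝ v u' := by
  have h : exteriorPower.map 2 (innerₗ W) (exteriorPower.ιMulti ℝ 2 ![u, v]) =
      exteriorPower.ιMulti ℝ 2 (innerₗ W ∘ ![u, v]) :=
    exteriorPower.map_apply_ιMulti _ _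
  simp only [hatMetric, wedge, LinearMap.comp_apply, h,
    exteriorPower.pairingDual_ιMulti_ιMulti]
  simp [Matrix.det_fin_two]
  ring

/-- The triple `(Ω_{ε,1}, Ω_{ε,2}, Ω_{ε,3})` of 2-vectors given by an orthonormal basis
`(e₁, e₂, e₃, e₄)` and a sign `ε`. -/
def stdTriple (ε : ℤˣ) (e : OrthonormalBasis (Fin 4) ℝ W) : Fin 3 → ⋀[ℝ]^2 W :=
  ![(1 / √2 : ℝ) • (wedge (e 0) (e 1) + ε • wedge (e 2) (e 3)),
    (1 / √2 : ℝ) • (wedge (e 0) (e 2) + ε • wedge (e 3) (e 1)),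
    (1 / √2 : ℝ) • (wedge (e 0) (e 3) + ε • wedge (e 1) (e 2))]

/-- The subspace `⋀²_ε W` of an oriented Euclidean space `W` of dimension 4. -/
def halfTwoVectors (o : Orientation ℝ W (Fin 4)) (ε : ℤˣ) : Submodule ℝ (⋀[ℝ]^2 W) :=
  Submodule.span ℝ {α | ∃ e : OrthonormalBasis (Fin 4) ℝ W,
    e.toBasis.orientation = o ∧ ∃ i, α = stdTriple ε e i}

/-- The fibre of the twistor space: the unit sphere of `⋀²_ε W`. -/
def twistorFibre (o : Orientation ℝ W (Fin 4)) (ε : ℤˣ) : Set (⋀[ℝ]^2 W) :=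
  {α | α ∈ halfTwoVectors o ε ∧ hatMetric α α = 1}

/-- `α` is an orthonormal basis of `⋀²_ε W` which is positive for the orientation of `⋀²_ε W`
given by the triples `stdTriple ε e`, where `e` is a positive orthonormal basis of `W`. -/
def IsPositiveFrame (o : Orientation ℝ W (Fin 4)) (ε : ℤˣ) (α : Fin 3 → ⋀[ℝ]^2 W) : Prop :=
  (∀ i j, hatMetric (α i) (α j) = if i = j then 1 else 0) ∧
  ∃ e : OrthonormalBasis (Fin 4) ℝ W, e.toBasis.orientation = o ∧
    ∃ P : Matrix (Fin 3) (Fin 3) ℝ, 0 < P.det ∧ ∀ j, α j = ∑ i, P i j • stdTriple ε e i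

end Fibre

/-! ### Horizontal sections of the twistor space -/

section Bundle

variable {E : Torus → Type*} [TopologicalSpace (TotalSpace R4 E)]
  [∀ x, NormedAddCommGroup (E x)] [∀ x, InnerProductSpace ℝ (E x)] [FiberBundle R4 E]

/-- The section `σ` of the bundle `E` is smooth. -/
def IsSmoothSection (σ : ∀ x, E x) : Prop :=
  ContMDiff torusModel (torusModel.prod 𝓘(ℝ, R4)) ∞ (fun x ↦ TotalSpace.mk' R4 x (σ x))

/-- The family `o` of orientations of the fibres is an orientation of the bundle `E`: four smooth
sections which form a positive basis at a point do so at all nearby points. -/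
def IsBundleOrientation (o : ∀ x, Orientation ℝ (E x) (Fin 4)) : Prop :=
  ∀ σ : Fin 4 → ∀ x, E x, (∀ i, IsSmoothSection (σ i)) →
    IsOpen {x | ∃ b : Module.Basis (Fin 4) ℝ (E x), (∀ i, b i = σ i x) ∧ b.orientation = o x}

/-- `D` is the covariant derivative at time `t`, with respect to the connection `∇̂` of `⋀² E`
induced by `∇`, of the section `Ω` of `⋀² E` along the curve `c`, restricted to times in `s`.
Near `t`, one writes `Ω = ∑ fᵢ (ξᵢ ∧ ηᵢ)` with smooth sections `ξᵢ`, `ηᵢ` of `E` and coefficients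
`fᵢ` that depend on time, and then
`D = ∑ (fᵢ' (ξᵢ ∧ ηᵢ) + fᵢ (∇ ξᵢ ∧ ηᵢ + ξᵢ ∧ ∇ ηᵢ))`, with `∇` taken along the velocity of `c`. -/
def HasCovDerivWithinAt (cov : CovariantDerivative torusModel R4 E) (c : ℝ → Torus)
    (Ω : ∀ t, ⋀[ℝ]^2 (E (c t))) (s : Set ℝ) (t : ℝ) (D : ⋀[ℝ]^2 (E (c t))) : Prop :=
  ∃ (n : ℕ) (f : Fin n → ℝ → ℝ) (f' : Fin n → ℝ) (ξ η : Fin n → ∀ x, E x),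
    (∀ i, IsSmoothSection (ξ i) ∧ IsSmoothSection (η i)) ∧
    (∀ i, HasDerivWithinAt (f i) (f' i) s t) ∧
    (∀ᶠ τ in 𝓝[s] t, Ω τ = ∑ i, f i τ • wedge (ξ i (c τ)) (η i (c τ))) ∧
    D = ∑ i, (f' i • wedge (ξ i (c t)) (η i (c t)) +
      f i t • (wedge (cov (ξ i) (c t) (velocity c t)) (η i (c t)) +
        wedge (ξ i (c t)) (cov (η i) (c t) (velocity c t))))

/-- `Ω` is a section of the twistor space `Ê_ε` along `c` over the times in `s`, and it is
horizontal with respect to `∇̂`. -/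
def IsHorizontalOn (cov : CovariantDerivative torusModel R4 E)
    (o : ∀ x, Orientation ℝ (E x) (Fin 4)) (ε : ℤˣ) (c : ℝ → Torus)
    (Ω : ∀ t, ⋀[ℝ]^2 (E (c t))) (s : Set ℝ) : Prop :=
  ∀ t ∈ s, Ω t ∈ twistorFibre (o (c t)) ε ∧ HasCovDerivWithinAt cov c Ω s t 0

/-! ### Normal polygonal curves and the complexity of horizontality -/

/-- A normal polygonal curve in `ℝ²` from `(0, 0)`, given by its successive vertices: each of its
line segments lies in a coordinate line, and its end points have the same image in `T²`. -/
structure NormalPolygonalCurve where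
  length : ℕ
  vertex : Fin (length + 1) → ℝ × ℝ
  start : vertex 0 = (0, 0)
  coord : ∀ i : Fin length, (vertex i.castSucc).1 = (vertex i.succ).1 ∨
    (vertex i.castSucc).2 = (vertex i.succ).2
  closed : ∀ i : Fin length, pr (vertex i.castSucc) = pr (vertex i.succ)

/-- The parallel transport with respect to `∇̂` along the line segment from `v` to `w` takes the
element `p` of the total space of `⋀² E` to `q`. -/
def SegmentTransport (cov : CovariantDerivative torusModel R4 E)
    (o : ∀ x, Orientation ℝ (E x) (Fin 4)) (ε : ℤˣ) (v w : ℝ × ℝ)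
    (p q : Σ x, ⋀[ℝ]^2 (E x)) : Prop :=
  ∃ Ω : ∀ t, ⋀[ℝ]^2 (E (segmentCurve v w t)),
    IsHorizontalOn cov o ε (segmentCurve v w) Ω (Icc 0 1) ∧
    p = ⟨segmentCurve v w 0, Ω 0⟩ ∧ q = ⟨segmentCurve v w 1, Ω 1⟩

/-- `α' = α_γ`: the parallel transport along `γ` takes `α` to `α'`. -/
def CurveTransport (cov : CovariantDerivative torusModel R4 E)
    (o : ∀ x, Orientation ℝ (E x) (Fin 4)) (ε : ℤˣ) (γ : NormalPolygonalCurve)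
    (α α' : ⋀[ℝ]^2 (E (pr (0, 0)))) : Prop :=
  ∃ τ : Fin (γ.length + 1) → Σ x, ⋀[ℝ]^2 (E x),
    τ 0 = ⟨pr (0, 0), α⟩ ∧ τ (Fin.last γ.length) = ⟨pr (0, 0), α'⟩ ∧
    ∀ i : Fin γ.length, SegmentTransport cov o ε (γ.vertex i.castSucc) (γ.vertex i.succ)
      (τ i.castSucc) (τ i.succ)

/-- The set `X(α) = {α_γ | γ a normal polygonal curve}`. -/
def transportSet (cov : CovariantDerivative torusModel R4 E)
    (o : ∀ x, Orientation ℝ (E x) (Fin 4)) (ε : ℤˣ) (α : ⋀[ℝ]^2 (E (pr (0, 0)))) :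
    Set (⋀[ℝ]^2 (E (pr (0, 0)))) :=
  {α' | ∃ γ : NormalPolygonalCurve, CurveTransport cov o ε γ α α'}

/-- The horizontality in `Ê_ε` with respect to `∇̂` has infinite complexity (for some element of
the fibre of `Ê_ε` on `pr (0, 0)`). -/
def HasInfiniteComplexity (cov : CovariantDerivative torusModel R4 E)
    (o : ∀ x, Orientation ℝ (E x) (Fin 4)) (ε : ℤˣ) : Prop :=
  ∃ α ∈ twistorFibre (o (pr (0, 0))) ε, (transportSet cov o ε α).Infinite

/-! ### The topological holonomy group -/

/-- The group `SO(3)`. -/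
abbrev SO3 : Type := Matrix.specialOrthogonalGroup (Fin 3) ℝ

/-- `C` is the matrix with `(Ω₁(a + 2π) Ω₂(a + 2π) Ω₃(a + 2π)) = (Ω₁(a) Ω₂(a) Ω₃(a)) C` for all
`a`, for a frame along the `2π`-periodic curve `c`; the equality is one in the total space. -/
def IsMonodromyMatrix (c : ℝ → Torus) (Ω : Fin 3 → ∀ t, ⋀[ℝ]^2 (E (c t))) (C : SO3) : Prop :=
  ∀ (a : ℝ) (i : Fin 3),
    (⟨c (a + 2 * Real.pi), Ω i (a + 2 * Real.pi)⟩ : Σ x, ⋀[ℝ]^2 (E x)) =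
      ⟨c a, ∑ j, (C : Matrix (Fin 3) (Fin 3) ℝ) j i • Ω j a⟩

/-- `H` is the topological holonomy group `G_{∇̂,ε}` of `∇̂` in `⋀²_ε E` at `pr (0, 0)`. It depends
on the choice of a positive orthonormal basis `α` of the fibre of `⋀²_ε E`, so it is determined up
to conjugation in `SO(3)`. -/
def IsTopologicalHolonomyGroup (cov : CovariantDerivative torusModel R4 E)
    (o : ∀ x, Orientation ℝ (E x) (Fin 4)) (ε : ℤˣ) (H : Subgroup SO3) : Prop :=
  ∃ (α : Fin 3 → ⋀[ℝ]^2 (E (pr (0, 0))))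
    (Ωx : Fin 3 → ∀ t, ⋀[ℝ]^2 (E (lineX t))) (Ωy : Fin 3 → ∀ t, ⋀[ℝ]^2 (E (lineY t)))
    (C₁ C₂ : SO3),
    IsPositiveFrame (o (pr (0, 0))) ε α ∧
    (∀ i, IsHorizontalOn cov o ε lineX (Ωx i) univ ∧ Ωx i 0 = α i) ∧
    (∀ i, IsHorizontalOn cov o ε lineY (Ωy i) univ ∧ Ωy i 0 = α i) ∧
    IsMonodromyMatrix lineX Ωx C₁ ∧ IsMonodromyMatrix lineY Ωy C₂ ∧
    H = Subgroup.closure {C₁, C₂}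

end Bundle

/-! ### Rotations -/

/-- The rotation matrix `C(θ)` about the first coordinate axis. -/
def rotMatrix (θ : ℝ) : Matrix (Fin 3) (Fin 3) ℝ :=
  !![1, 0, 0; 0, Real.cos θ, -Real.sin θ; 0, Real.sin θ, Real.cos θ]

/-- `θ` is an angle of rotation by `C`. -/
def IsRotationAngle (C : SO3) (θ : ℝ) : Prop :=
  ∃ V : SO3, (C : Matrix (Fin 3) (Fin 3) ℝ) =
    (V : Matrix (Fin 3) (Fin 3) ℝ) * rotMatrix θ * (V : Matrix (Fin 3) (Fin 3) ℝ).transpose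

/-- `u` is an eigenvector of `C` corresponding to the eigenvalue `1`. -/
def IsAxisVector (C : SO3) (u : EuclideanSpace ℝ (Fin 3)) : Prop :=
  Module.End.HasEigenvector (Matrix.toEuclideanLin (C : Matrix (Fin 3) (Fin 3) ℝ)) 1 u

/-- `φ ∈ (0, π/2]` is the angle between the eigendirections of `C₁`, `C₂` corresponding to the
eigenvalue `1`. -/
def IsAxisAngle (C₁ C₂ : SO3) (φ : ℝ) : Prop :=
  φ ∈ Ioc 0 (Real.pi / 2) ∧
    ∃ u v, IsAxisVector C₁ u ∧ IsAxisVector C₂ v ∧ InnerProductGeometry.angle u v = φ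

/-- `G` is generated by two rotations `C₁'`, `C₂'` which are obtained from two generators `C₁`, `C₂`
of a finite non-cyclic subgroup `G₀` of `SO(3)` by halving one of the angles of rotation and keeping
the other one and the angle between the axes. -/
def IsHalvedAngleGroup (G : Subgroup SO3) : Prop :=
  ∃ (G₀ : Subgroup SO3) (C₁ C₂ C₁' C₂' : SO3) (θ₁ θ₂ θ₁' θ₂' φ : ℝ),
    Finite G₀ ∧ ¬ IsCyclic G₀ ∧ G₀ = Subgroup.closure {C₁, C₂} ∧
    θ₁ ∈ Ioo 0 (2 * Real.pi) ∧ θ₂ ∈ Ioo 0 (2 * Real.pi) ∧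
    IsRotationAngle C₁ θ₁ ∧ IsRotationAngle C₂ θ₂ ∧ IsAxisAngle C₁ C₂ φ ∧
    ((θ₁' = θ₁ / 2 ∧ θ₂' = θ₂) ∨ (θ₁' = θ₁ ∧ θ₂' = θ₂ / 2)) ∧
    IsRotationAngle C₁' θ₁' ∧ IsRotationAngle C₂' θ₂' ∧ IsAxisAngle C₁' C₂' φ ∧
    G = Subgroup.closure {C₁', C₂'}

/-- Condition (A): neither square is the identity matrix. -/
def ConditionA (C : Fin 2 → SO3) : Prop := ∀ k, C k ^ 2 ≠ 1

/-- Condition (B): eigenvectors of the two rotations corresponding to the eigenvalue `1` are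
linearly independent. (Every element of `SO(3)` has such eigenvectors; under condition (A) each of
the two eigenspaces is a line, so that the choice of the eigenvectors does not matter.) -/
def ConditionB (C : Fin 2 → SO3) : Prop :=
  ∀ u v, IsAxisVector (C 0) u → IsAxisVector (C 1) v → LinearIndependent ℝ ![u, v]

/-- Condition (C): for one of the two rotations, an eigenvalue other than `1` is `exp (i ψ π)` for
an irrational real number `ψ`. -/
def ConditionC (C : Fin 2 → SO3) : Prop :=
  ∃ (k : Fin 2) (ζ : ℂ) (ψ : ℝ),
    Module.End.HasEigenvalue
      (Matrix.toLin' ((C k : Matrix (Fin 3) (Fin 3) ℝ).map (algebraMap ℝ ℂ))) ζ ∧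
    ζ ≠ 1 ∧ Irrational ψ ∧ ζ = Complex.exp (Complex.I * ψ * Real.pi)

end TopHolonomy

end

/-! Parallel transport along the axes is isometric, so in a frame it acts through powers of the two
monodromy matrices. Every vertex of a normal polygonal curve lies over the base point, and every
segment is a whole number of turns around an axis. Hence each set X(ω) lies in an orbit of H, and
infinite complexity forces H to be infinite (`IsTopologicalHolonomyGroup.infinite`).

By Burnside and Schur, a finitely generated torsion group of matrices is finite, so H has an element
g of infinite order (`exists_not_isOfFinOrder`). Let u span its axis. If some h in H moves the line
of u, then g and its conjugate by h are the required pair: both have infinite order, which gives (A)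
and (C), and their axes are spanned by u and hu, which gives (B).

Otherwise H preserves the line of u, and this is impossible. The isomorphism of H with G is abstract
and carries no geometry, so the situation is first put in algebraic form: squares in H fix u, hence
commute. Squares in G therefore commute as well, and the image of g has infinite order. This forces
G to preserve the axis of that image (`act_eq_or_eq_neg_of_commute_sq`). But a halved angle lies in
(0, π), so the halved generator is not a half-turn and cannot reverse the line. It fixes the line
pointwise, and the other generator, having a different axis, reverses it. So G is generated by a
rotation of finite order and a half-turn inverting it, and all its elements have finite order
(`IsHalvedAngleGroup.isOfFinOrder_of_preserves_line`), a contradiction. -/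

noncomputable section

namespace TopHolonomy

/-! ### Complementary minors of a rotation of a four-dimensional space -/

/-- The 2×2 minor of a 4×4 matrix on the rows `i`, `j` and the columns `k`, `l`. -/
def minor (Q : Matrix (Fin 4) (Fin 4) ℝ) (i j k l : Fin 4) : ℝ := Q i k * Q j l - Q i l * Q j k

/-- Jacobi's argument: replace the first two columns of the identity by the first two rows of Q.
Multiplying by Q turns these columns back into unit vectors and the other two into columns of Q;
then compare determinants. -/
theorem minor_complement (Q : Matrix (Fin 4) (Fin 4) ℝ) (hQ : Q * Q.transpose = 1)
    (hdet : Q.det = 1) : minor Q 0 1 0 1 = minor Q 2 3 2 3 := by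
  let X : Matrix (Fin 4) (Fin 4) ℝ :=
    Matrix.of fun i j ↦ if j = 0 then Q 0 i else if j = 1 then Q 1 i else (1 : Matrix _ _ ℝ) i j
  let Y : Matrix (Fin 4) (Fin 4) ℝ :=
    Matrix.of fun i j ↦ if j = 0 ∨ j = 1 then (1 : Matrix _ _ ℝ) i j else Q i j
  have hXY : Q * X = Y := by
    ext i j
    have h := fun k ↦ congrFun (congrFun hQ i) k
    simp only [Matrix.mul_apply, Matrix.transpose_apply, Fin.sum_univ_four] at h ⊢
    fin_cases j
    · simpa [X, Y] using h 0
    · simpa [X, Y] using h 1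
    · simp [X, Y, Matrix.one_apply]
    · simp [X, Y, Matrix.one_apply]
  have hX : X.det = minor Q 0 1 0 1 := by
    simp [X, minor, Matrix.det_succ_row_zero, Fin.sum_univ_succ, Fin.succAbove, Matrix.one_apply]
    ring
  have hY : Y.det = minor Q 2 3 2 3 := by
    simp [Y, minor, Matrix.det_succ_row_zero, Fin.sum_univ_succ, Fin.succAbove, Matrix.one_apply]
    ring
  rw [← hX, ← hY, ← hXY, Matrix.det_mul, hdet, one_mul]

theorem minor_complement_perm (Q : Matrix (Fin 4) (Fin 4) ℝ) (hQ : Q * Q.transpose = 1)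
    (hdet : Q.det = 1) (σ τ : Equiv.Perm (Fin 4)) (hσ : Equiv.Perm.sign σ = 1)
    (hτ : Equiv.Perm.sign τ = 1) :
    minor Q (σ 0) (σ 1) (τ 0) (τ 1) = minor Q (σ 2) (σ 3) (τ 2) (τ 3) := by
  refine minor_complement (Q.submatrix σ τ) ?_ ?_
  · rw [Matrix.transpose_submatrix, Matrix.submatrix_mul_equiv, hQ]
    simp
  · have h : Q.submatrix σ τ = (Q.submatrix σ id).submatrix id τ := rfl
    rw [h, Matrix.det_permute', Matrix.det_permute, hσ, hτ, hdet]
    simp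

/-! ### Invariance of the half spaces of 2-vectors under positive changes of frame -/

section Fibre

variable {W : Type*} [NormedAddCommGroup W] [InnerProductSpace ℝ W]

theorem update_pair_zero {X : Type*} (u v x : X) : Function.update ![u, v] 0 x = ![x, v] := by
  ext i; fin_cases i <;> rfl

theorem wedge_add_left (u u' v : W) : wedge (u + u') v = wedge u v + wedge u' v := by
  have h := (exteriorPower.ιMulti ℝ 2 (M := W)).map_update_add ![u, v] 0 u u'
  simpa only [update_pair_zero] using! h

theorem wedge_smul_left (r : ℝ) (u v : W) : wedge (r • u) v = r • wedge u v := by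
  have h := (exteriorPower.ιMulti ℝ 2 (M := W)).map_update_smul ![u, v] 0 r u
  simpa only [update_pair_zero] using! h

theorem wedge_swap (u v : W) : wedge v u = -wedge u v := by
  have := (exteriorPower.ιMulti ℝ 2 (M := W)).map_swap ![u, v] (i := 0) (j := 1) (by simp)
  rw [wedge, wedge, ← this]
  congr 1
  ext i; fin_cases i <;> simp

theorem wedge_self (u : W) : wedge u u = 0 := by
  exact (exteriorPower.ιMulti ℝ 2 (M := W)).map_eq_zero_of_eq ![u, u] (i := 0) (j := 1) rfl
    (by simp)

theorem wedge_add_right (u v v' : W) : wedge u (v + v') = wedge u v + wedge u v' := by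
  rw [wedge_swap, wedge_add_left, wedge_swap u v, wedge_swap u v', neg_add]; simp

theorem wedge_smul_right (r : ℝ) (u v : W) : wedge u (r • v) = r • wedge u v := by
  rw [wedge_swap, wedge_smul_left, wedge_swap u v]; simp

theorem wedge_expand (e : Fin 4 → W) (Q : Matrix (Fin 4) (Fin 4) ℝ) (i j : Fin 4) :
    wedge (∑ k, Q i k • e k) (∑ k, Q j k • e k) =
      minor Q i j 0 1 • wedge (e 0) (e 1) + minor Q i j 0 2 • wedge (e 0) (e 2) +
      minor Q i j 0 3 • wedge (e 0) (e 3) + minor Q i j 1 2 • wedge (e 1) (e 2) +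
      minor Q i j 1 3 • wedge (e 1) (e 3) + minor Q i j 2 3 • wedge (e 2) (e 3) := by
  simp only [Fin.sum_univ_four, wedge_add_left, wedge_add_right, wedge_smul_left,
    wedge_smul_right, wedge_self, wedge_swap (e 0) (e 1), wedge_swap (e 0) (e 2),
    wedge_swap (e 0) (e 3), wedge_swap (e 1) (e 2), wedge_swap (e 1) (e 3), wedge_swap (e 2) (e 3),
    minor]
  module

/-- A positive change of orthonormal frame has equal complementary minors, so it commutes with the
exchange of complementary 2-vectors. This is why one positive frame already spans `halfTwoVectors`.
-/
theorem wedge_add_wedge_mem_span {o : Orientation ℝ W (Fin 4)} (ε : ℤˣ)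
    (e e' : OrthonormalBasis (Fin 4) ℝ W) (he : e.toBasis.orientation = o)
    (he' : e'.toBasis.orientation = o) (σ : Equiv.Perm (Fin 4)) (hσ : Equiv.Perm.sign σ = 1) :
    wedge (e' (σ 0)) (e' (σ 1)) + ε • wedge (e' (σ 2)) (e' (σ 3)) ∈
      Submodule.span ℝ (Set.range (stdTriple ε e)) := by
  let Q : Matrix (Fin 4) (Fin 4) ℝ := (e.toBasis.toMatrix e').transpose
  have hdet : Q.det = 1 := by
    have h := e.det_to_matrix_orthonormalBasis_of_same_orientation e' (he.trans he'.symm)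
    rwa [Module.Basis.det_apply, ← Matrix.det_transpose] at h
  have hQ : Q * Q.transpose = 1 := by
    have h := e.toMatrix_orthonormalBasis_mem_unitary e'
    have h' := (Matrix.mem_orthogonalGroup_iff' (Fin 4) ℝ).mp h
    simpa [Q, Matrix.star_eq_conjTranspose] using h'
  have hexp : ∀ i, e' i = ∑ k, Q i k • e k := fun i ↦ by
    have h := e.toBasis.sum_toMatrix_smul_self e' i
    simpa [Q] using h.symm
  -- Both permutations are even: `s` exchanges the pairs 01 and 23, and `c` is the cycle 1 → 2 → 3 →
  -- 1, which permutes the splittings 01|23, 02|31, 03|12. Together they reach all six column pairs.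
  let s : Equiv.Perm (Fin 4) := Equiv.swap 0 2 * Equiv.swap 1 3
  let c : Equiv.Perm (Fin 4) := Equiv.swap 1 2 * Equiv.swap 2 3
  have key := fun τ ↦ minor_complement_perm Q hQ hdet σ τ hσ
  have h1 : minor Q (σ 0) (σ 1) 0 1 = minor Q (σ 2) (σ 3) 2 3 := key 1 (by simp)
  have h2 : minor Q (σ 0) (σ 1) 0 2 = minor Q (σ 2) (σ 3) 3 1 := key c (by decide)
  have h3 : minor Q (σ 0) (σ 1) 0 3 = minor Q (σ 2) (σ 3) 1 2 := key (c * c) (by decide)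
  have h4 : minor Q (σ 0) (σ 1) 2 3 = minor Q (σ 2) (σ 3) 0 1 := key s (by decide)
  have h5 : minor Q (σ 0) (σ 1) 3 1 = minor Q (σ 2) (σ 3) 0 2 := key (c * s) (by decide)
  have h6 : minor Q (σ 0) (σ 1) 1 2 = minor Q (σ 2) (σ 3) 0 3 := key (c * c * s) (by decide)
  have hneg : ∀ i j, minor Q i j 3 1 = -minor Q i j 1 3 := fun i j ↦ by simp [minor]
  rw [hneg] at h2 h5
  have hsum : wedge (e' (σ 0)) (e' (σ 1)) + ε • wedge (e' (σ 2)) (e' (σ 3)) =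
      (√2 * (minor Q (σ 0) (σ 1) 0 1 + ε • minor Q (σ 2) (σ 3) 0 1)) • stdTriple ε e 0 +
      (√2 * (minor Q (σ 0) (σ 1) 0 2 + ε • minor Q (σ 2) (σ 3) 0 2)) • stdTriple ε e 1 +
      (√2 * (minor Q (σ 0) (σ 1) 0 3 + ε • minor Q (σ 2) (σ 3) 0 3)) • stdTriple ε e 2 := by
    have hr : ∀ r : ℝ, √2 * r * (1 / √2) = r := fun r ↦ by field_simp
    have hstd : stdTriple ε e 0 = (1 / √2 : ℝ) • (wedge (e 0) (e 1) + ε • wedge (e 2) (e 3)) ∧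
      stdTriple ε e 1 = (1 / √2 : ℝ) • (wedge (e 0) (e 2) + ε • wedge (e 3) (e 1)) ∧
      stdTriple ε e 2 = (1 / √2 : ℝ) • (wedge (e 0) (e 3) + ε • wedge (e 1) (e 2)) :=
      ⟨rfl, rfl, rfl⟩
    rw [hstd.1, hstd.2.1, hstd.2.2, smul_smul, smul_smul, smul_smul, hr, hr, hr,
      hexp, hexp (σ 1), hexp (σ 2), hexp (σ 3), wedge_expand, wedge_expand,
      wedge_swap (e 1) (e 3), h4, h6, ← h1, ← h3, ← h5]
    rw [neg_eq_iff_eq_neg.mp h2.symm]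
    rcases Int.units_eq_one_or ε with rfl | rfl <;> simp only [one_smul, Units.neg_smul] <;>
      module
  rw [hsum]
  have hmem : ∀ i, stdTriple ε e i ∈ Submodule.span ℝ (Set.range (stdTriple ε e)) :=
    fun i ↦ Submodule.subset_span ⟨i, rfl⟩
  exact add_mem (add_mem (Submodule.smul_mem _ _ (hmem 0)) (Submodule.smul_mem _ _ (hmem 1)))
    (Submodule.smul_mem _ _ (hmem 2))

theorem stdTriple_mem_span {o : Orientation ℝ W (Fin 4)} (ε : ℤˣ)
    (e e' : OrthonormalBasis (Fin 4) ℝ W) (he : e.toBasis.orientation = o)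
    (he' : e'.toBasis.orientation = o) (i : Fin 3) :
    stdTriple ε e' i ∈ Submodule.span ℝ (Set.range (stdTriple ε e)) := by
  have key := wedge_add_wedge_mem_span ε e e' he he'
  let c : Equiv.Perm (Fin 4) := Equiv.swap 1 2 * Equiv.swap 2 3
  fin_cases i
  · exact Submodule.smul_mem _ _ (key 1 (by simp))
  · exact Submodule.smul_mem _ _ (key c (by decide))
  · exact Submodule.smul_mem _ _ (key (c * c) (by decide))

theorem mem_halfTwoVectors_iff {o : Orientation ℝ W (Fin 4)} {ε : ℤˣ}
    {e : OrthonormalBasis (Fin 4) ℝ W} (he : e.toBasis.orientation = o) {β : ⋀[ℝ]^2 W} :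
    β ∈ halfTwoVectors o ε ↔ β ∈ Submodule.span ℝ (Set.range (stdTriple ε e)) := by
  suffices h : halfTwoVectors o ε = Submodule.span ℝ (Set.range (stdTriple ε e)) by rw [h]
  refine le_antisymm (Submodule.span_le.mpr ?_) (Submodule.span_mono ?_)
  · rintro _ ⟨e', he', i, rfl⟩
    exact stdTriple_mem_span ε e e' he he' i
  · rintro _ ⟨i, rfl⟩
    exact ⟨e, he, i, rfl⟩

/-- An element of `⋀²_ε W` is the sum of its components in a positive frame. -/
theorem IsPositiveFrame.sum_hatMetric_smul {o : Orientation ℝ W (Fin 4)} {ε : ℤˣ}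
    {α : Fin 3 → ⋀[ℝ]^2 W} (hα : IsPositiveFrame o ε α) {β : ⋀[ℝ]^2 W}
    (hβ : β ∈ halfTwoVectors o ε) : β = ∑ i, hatMetric β (α i) • α i := by
  obtain ⟨hortho, e, he, P, hP, hαP⟩ := hα
  have hstd : ∀ i, stdTriple ε e i ∈ Submodule.span ℝ (Set.range α) := fun i ↦ by
    have h : stdTriple ε e i = ∑ j, P⁻¹ j i • α j := by
      have hPP : P * P⁻¹ = 1 := Matrix.mul_nonsing_inv P (isUnit_iff_ne_zero.mpr hP.ne')
      simp only [hαP, Finset.smul_sum, smul_smul]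
      rw [Finset.sum_comm]
      simp only [← Finset.sum_smul]
      have h' : ∀ k, ∑ j, P⁻¹ j i * P k j = if k = i then 1 else 0 := fun k ↦ by
        rw [← Matrix.one_apply, ← hPP, Matrix.mul_apply]
        exact Finset.sum_congr rfl fun _ _ ↦ mul_comm _ _
      simp [h']
    rw [h]
    exact Submodule.sum_mem _ fun j _ ↦ Submodule.smul_mem _ _ (Submodule.subset_span ⟨j, rfl⟩)
  have hspan : β ∈ Submodule.span ℝ (Set.range α) := by
    refine Submodule.span_le.mpr ?_ ((mem_halfTwoVectors_iff he).mp hβ)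
    rintro _ ⟨i, rfl⟩
    exact hstd i
  obtain ⟨c, rfl⟩ := (Submodule.mem_span_range_iff_exists_fun ℝ).mp hspan
  simp [hortho]

end Fibre

/-! ### Parallel transport is isometric -/

section Bundle

variable {E : Torus → Type*} [TopologicalSpace (TotalSpace R4 E)]
  [∀ x, NormedAddCommGroup (E x)] [∀ x, InnerProductSpace ℝ (E x)] [FiberBundle R4 E]

section Metric

variable [VectorBundle ℝ R4 E] [ContMDiffVectorBundle ∞ R4 E torusModel]
  [IsContMDiffRiemannianBundle torusModel ∞ R4 E]

theorem hasDerivAt_inner {cov : CovariantDerivative torusModel R4 E}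
    (hcov : cov.IsMetricCompatible) {c : ℝ → Torus} {t : ℝ}
    (hc : MDifferentiableAt 𝓘(ℝ, ℝ) torusModel c t) {σ τ : ∀ x, E x}
    (hσ : IsSmoothSection σ) (hτ : IsSmoothSection τ) :
    HasDerivAt (fun s ↦ inner ℝ (σ (c s)) (τ (c s)))
      (inner ℝ (cov σ (c t) (velocity c t)) (τ (c t)) +
        inner ℝ (σ (c t)) (cov τ (c t) (velocity c t))) t := by
  have hσ' := hσ.mdifferentiableAt (x := c t) (by simp)
  have hτ' := hτ.mdifferentiableAt (x := c t) (by simp)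
  have hf : MDifferentiableAt torusModel 𝓘(ℝ, ℝ) (fun x ↦ inner ℝ (σ x) (τ x)) (c t) :=
    hσ'.inner_bundle hτ'
  have hX := hcov.mvfderiv_inner_eq (x := c t) (fun _ ↦ velocity c t) hσ' hτ'
  let L : ℝ →L[ℝ] ℝ := (mfderiv torusModel 𝓘(ℝ, ℝ) (fun x ↦ inner ℝ (σ x) (τ x)) (c t)).comp
    (mfderiv 𝓘(ℝ, ℝ) torusModel c t)
  have h : HasFDerivAt (fun s ↦ inner ℝ (σ (c s)) (τ (c s))) L t :=
    (hf.hasMFDerivAt.comp t hc.hasMFDerivAt).hasFDerivAt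
  exact h.hasDerivAt.congr_deriv hX

/-- The metric on 2-vectors is parallel, in terms of decompositions into products. -/
theorem hasDerivAt_hatMetric_wedge {cov : CovariantDerivative torusModel R4 E}
    (hcov : cov.IsMetricCompatible) {c : ℝ → Torus} {t : ℝ}
    (hc : MDifferentiableAt 𝓘(ℝ, ℝ) torusModel c t) {ξ η ξ' η' : ∀ x, E x}
    (hξ : IsSmoothSection ξ) (hη : IsSmoothSection η)
    (hξ' : IsSmoothSection ξ') (hη' : IsSmoothSection η') :
    HasDerivAt (fun s ↦ hatMetric (wedge (ξ (c s)) (η (c s))) (wedge (ξ' (c s)) (η' (c s))))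
      (hatMetric (wedge (cov ξ (c t) (velocity c t)) (η (c t)) +
          wedge (ξ (c t)) (cov η (c t) (velocity c t))) (wedge (ξ' (c t)) (η' (c t))) +
        hatMetric (wedge (ξ (c t)) (η (c t))) (wedge (cov ξ' (c t) (velocity c t)) (η' (c t)) +
          wedge (ξ' (c t)) (cov η' (c t) (velocity c t)))) t := by
  simp only [map_add, LinearMap.add_apply, hatMetric_wedge]
  refine ((hasDerivAt_inner hcov hc hξ hξ').mul (hasDerivAt_inner hcov hc hη hη')).sub
    ((hasDerivAt_inner hcov hc hξ hη').mul (hasDerivAt_inner hcov hc hη hξ')) |>.congr_deriv ?_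
  ring

/-- The product rule is applied to whichever local decompositions witness the two derivatives, so
their independence of the decomposition is never needed. -/
theorem HasCovDerivWithinAt.hasDerivWithinAt_hatMetric
    {cov : CovariantDerivative torusModel R4 E} (hcov : cov.IsMetricCompatible) {c : ℝ → Torus}
    {t : ℝ} {s : Set ℝ} (hc : MDifferentiableAt 𝓘(ℝ, ℝ) torusModel c t) (ht : t ∈ s)
    {Ω Ω' : ∀ t, ⋀[ℝ]^2 (E (c t))} {D D' : ⋀[ℝ]^2 (E (c t))}
    (hΩ : HasCovDerivWithinAt cov c Ω s t D) (hΩ' : HasCovDerivWithinAt cov c Ω' s t D') :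
    HasDerivWithinAt (fun τ ↦ hatMetric (Ω τ) (Ω' τ))
      (hatMetric D (Ω' t) + hatMetric (Ω t) D') s t := by
  obtain ⟨n, f, f', ξ, η, hsm, hf, hrep, rfl⟩ := hΩ
  obtain ⟨m, g, g', ξ', η', hsm', hg, hrep', rfl⟩ := hΩ'
  have ht1 := hrep.self_of_nhdsWithin ht
  have ht2 := hrep'.self_of_nhdsWithin ht
  have key : HasDerivWithinAt (fun τ ↦ ∑ i, ∑ j, f i τ * g j τ *
      hatMetric (wedge (ξ i (c τ)) (η i (c τ))) (wedge (ξ' j (c τ)) (η' j (c τ)))) _ s t :=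
    HasDerivWithinAt.fun_sum fun i _ ↦ HasDerivWithinAt.fun_sum fun j _ ↦
      ((hf i).mul (hg j)).mul (hasDerivAt_hatMetric_wedge hcov hc (hsm i).1 (hsm i).2
        (hsm' j).1 (hsm' j).2).hasDerivWithinAt
  have heq : (fun τ ↦ hatMetric (Ω τ) (Ω' τ)) =ᶠ[𝓝[s] t] fun τ ↦ ∑ i, ∑ j, f i τ * g j τ *
      hatMetric (wedge (ξ i (c τ)) (η i (c τ))) (wedge (ξ' j (c τ)) (η' j (c τ))) := by
    filter_upwards [hrep, hrep'] with τ h1 h2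
    rw [h1, h2]
    simp only [map_sum, LinearMap.sum_apply, map_smul, LinearMap.smul_apply, smul_eq_mul]
    simp only [Finset.mul_sum]
    rw [Finset.sum_comm]
    exact Finset.sum_congr rfl fun i _ ↦ Finset.sum_congr rfl fun j _ ↦ by ring
  refine (key.congr_of_eventuallyEq_of_mem heq ht).congr_deriv ?_
  rw [ht1, ht2]
  simp only [map_sum, LinearMap.sum_apply, map_smul, LinearMap.smul_apply, smul_eq_mul, map_add,
    LinearMap.add_apply]
  simp only [← Finset.sum_add_distrib, Finset.mul_sum]
  rw [Finset.sum_comm]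
  refine Finset.sum_congr rfl fun i _ ↦ Finset.sum_congr rfl fun j _ ↦ ?_
  simp only [Pi.mul_apply]
  ring

theorem hatMetric_eq_of_isHorizontalOn {cov : CovariantDerivative torusModel R4 E}
    (hcov : cov.IsMetricCompatible) {c : ℝ → Torus}
    (hc : ∀ t, MDifferentiableAt 𝓘(ℝ, ℝ) torusModel c t)
    {Ω Ω' : ∀ t, ⋀[ℝ]^2 (E (c t))}
    (hΩ : ∀ t ∈ Icc (0 : ℝ) 1, HasCovDerivWithinAt cov c Ω (Icc 0 1) t 0)
    (hΩ' : ∀ t ∈ Icc (0 : ℝ) 1, HasCovDerivWithinAt cov c Ω' (Icc 0 1) t 0) :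
    hatMetric (Ω 1) (Ω' 1) = hatMetric (Ω 0) (Ω' 0) := by
  have hder : ∀ t ∈ Icc (0 : ℝ) 1,
      HasDerivWithinAt (fun τ ↦ hatMetric (Ω τ) (Ω' τ)) 0 (Icc 0 1) t := fun t ht ↦ by
    simpa using (hΩ t ht).hasDerivWithinAt_hatMetric hcov (hc t) ht (hΩ' t ht)
  exact (convex_Icc (0 : ℝ) 1).is_const_of_fderivWithin_eq_zero
    (fun t ht ↦ (hder t ht).differentiableWithinAt) (fun t ht ↦ by
      have := (hder t ht).hasFDerivWithinAt.fderivWithin ((uniqueDiffOn_Icc zero_lt_one) t ht)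
      rw [this]; ext; simp) (by simp) (by simp)

end Metric

/-! ### Affine changes of the parameter -/

/-- Compares the frames along the axes with segments parametrised by [0, 1]. The derivative scales
by `a`, so being horizontal is preserved, also for `a` zero or negative. -/
theorem HasCovDerivWithinAt.comp_affine {cov : CovariantDerivative torusModel R4 E}
    {c : ℝ → Torus} (hc : ∀ t, MDifferentiableAt 𝓘(ℝ, ℝ) torusModel c t)
    {Ω : ∀ t, ⋀[ℝ]^2 (E (c t))} (a : ℝ) (s : Set ℝ) (t : ℝ)
    (hΩ : HasCovDerivWithinAt cov c Ω univ (a * t) 0) :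
    HasCovDerivWithinAt cov (fun τ ↦ c (a * τ)) (fun τ ↦ Ω (a * τ)) s t 0 := by
  obtain ⟨n, f, f', ξ, η, hsm, hf, hrep, h0⟩ := hΩ
  have ha : HasDerivAt (fun τ : ℝ ↦ a * τ) a t := by simpa using (hasDerivAt_id t).const_mul a
  have hvel : velocity (fun τ ↦ c (a * τ)) t = a • velocity c (a * t) := by
    have h := (hc (a * t)).hasMFDerivAt.comp t (f := fun τ : ℝ ↦ a * τ)
      ha.hasFDerivAt.hasMFDerivAt
    let L : ℝ →L[ℝ] TangentSpace torusModel (c (a * t)) := mfderiv 𝓘(ℝ, ℝ) torusModel c (a * t)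
    have hL : L (ContinuousLinearMap.toSpanSingleton ℝ a 1) = a • L 1 := by
      rw [← map_smul]; simp
    change mfderiv 𝓘(ℝ, ℝ) torusModel (c ∘ fun τ : ℝ ↦ a * τ) t (1 : ℝ) = _
    rw [h.mfderiv]
    exact hL
  refine ⟨n, fun i τ ↦ f i (a * τ), fun i ↦ a * f' i, ξ, η, hsm, fun i ↦ ?_, ?_, ?_⟩
  · have := ((hf i).hasDerivAt univ_mem).comp t ha
    simpa [mul_comm] using! this.hasDerivWithinAt
  · rw [nhdsWithin_univ] at hrep
    exact (ha.continuousAt.eventually hrep).filter_mono nhdsWithin_le_nhds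
  · have h := congrArg (fun x ↦ a • x) h0
    simp only [smul_zero, Finset.smul_sum] at h
    rw [h]
    refine Finset.sum_congr rfl fun i _ ↦ ?_
    rw [hvel, map_smul, map_smul, wedge_smul_left, wedge_smul_right]
    module

theorem mdifferentiableAt_pr_comp {f g : ℝ → ℝ} (hf : ContDiff ℝ ∞ f) (hg : ContDiff ℝ ∞ g)
    (t : ℝ) :
    MDifferentiableAt 𝓘(ℝ, ℝ) torusModel (fun t ↦ pr (f t, g t)) t := by
  have h1 := (contMDiff_circleExp (m := ∞)).comp hf.contMDiff
  have h2 := (contMDiff_circleExp (m := ∞)).comp hg.contMDiff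
  exact (h1.prodMk h2).mdifferentiableAt (by simp)

end Bundle

/-! ### Parallel transport along normal polygonal curves -/

section Bundle

variable {E : Torus → Type*} [∀ x, NormedAddCommGroup (E x)] [∀ x, InnerProductSpace ℝ (E x)]

theorem mdifferentiableAt_lineX (t : ℝ) : MDifferentiableAt 𝓘(ℝ, ℝ) torusModel lineX t :=
  mdifferentiableAt_pr_comp contDiff_id contDiff_const t

theorem mdifferentiableAt_lineY (t : ℝ) : MDifferentiableAt 𝓘(ℝ, ℝ) torusModel lineY t :=
  mdifferentiableAt_pr_comp contDiff_const contDiff_id t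

/-- The base points after whole turns agree only propositionally, so vectors are compared in the
total space; this and the next lemmas carry linear algebra across such equalities. -/
theorem sigma_mk_sum_eq {x y : Torus} {u : Fin 3 → ⋀[ℝ]^2 (E x)} {v : Fin 3 → ⋀[ℝ]^2 (E y)}
    (h : ∀ j, (⟨x, u j⟩ : Σ x, ⋀[ℝ]^2 (E x)) = ⟨y, v j⟩) (k : Fin 3 → ℝ) :
    (⟨x, ∑ j, k j • u j⟩ : Σ x, ⋀[ℝ]^2 (E x)) = ⟨y, ∑ j, k j • v j⟩ := by
  obtain rfl : x = y := congrArg Sigma.fst (h 0)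
  have huv : u = v := funext fun j ↦ eq_of_heq (Sigma.mk.inj (h j)).2
  rw [huv]

theorem hatMetric_eq_of_sigma_mk_eq {x y : Torus} {u u' : ⋀[ℝ]^2 (E x)} {v v' : ⋀[ℝ]^2 (E y)}
    (h : (⟨x, u⟩ : Σ x, ⋀[ℝ]^2 (E x)) = ⟨y, v⟩) (h' : (⟨x, u'⟩ : Σ x, ⋀[ℝ]^2 (E x)) = ⟨y, v'⟩) :
    hatMetric u u' = hatMetric v v' := by
  cases h; cases h'; rfl

theorem exists_sigma_mk_eq {x y : Torus} (h : x = y) (u : ⋀[ℝ]^2 (E x)) :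
    ∃ v, (⟨x, u⟩ : Σ x, ⋀[ℝ]^2 (E x)) = ⟨y, v⟩ := by
  subst h
  exact ⟨u, rfl⟩

theorem sigma_mk_congr {c : ℝ → Torus} (Ω : ∀ t, ⋀[ℝ]^2 (E (c t))) {a b : ℝ} (h : a = b) :
    (⟨c a, Ω a⟩ : Σ x, ⋀[ℝ]^2 (E x)) = ⟨c b, Ω b⟩ := by
  rw [h]

theorem sum_smul_sum_smul {W : Type*} [AddCommGroup W] [Module ℝ W]
    (A B : Matrix (Fin 3) (Fin 3) ℝ) (u : Fin 3 → W) (i : Fin 3) :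
    ∑ j, B j i • ∑ k, A k j • u k = ∑ k, (A * B) k i • u k := by
  simp only [Finset.smul_sum, smul_smul, Matrix.mul_apply, Finset.sum_smul]
  rw [Finset.sum_comm]
  simp only [mul_comm]

theorem sum_one_smul {W : Type*} [AddCommGroup W] [Module ℝ W] (u : Fin 3 → W) (i : Fin 3) :
    ∑ k, (1 : Matrix (Fin 3) (Fin 3) ℝ) k i • u k = u i := by
  simp [Matrix.one_apply]

theorem IsMonodromyMatrix.zpow {c : ℝ → Torus} {Ω : Fin 3 → ∀ t, ⋀[ℝ]^2 (E (c t))} {C : SO3}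
    (hC : IsMonodromyMatrix c Ω C) (m : ℤ) (a : ℝ) (i : Fin 3) :
    (⟨c (a + 2 * Real.pi * m), Ω i (a + 2 * Real.pi * m)⟩ : Σ x, ⋀[ℝ]^2 (E x)) =
      ⟨c a, ∑ j, ((C ^ m : SO3) : Matrix (Fin 3) (Fin 3) ℝ) j i • Ω j a⟩ := by
  induction m generalizing i with
  | zero =>
    refine (sigma_mk_congr (Ω i) (show a + 2 * Real.pi * (0 : ℤ) = a by simp)).trans
      (congrArg (Sigma.mk (β := fun x ↦ ⋀[ℝ]^2 (E x)) (c a)) ?_)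
    exact (sum_one_smul (fun j ↦ Ω j a) i).symm
  | succ m ih =>
    refine (sigma_mk_congr (Ω i) (show a + 2 * Real.pi * ((m : ℤ) + 1 : ℤ) =
      a + 2 * Real.pi * (m : ℤ) + 2 * Real.pi by push_cast; ring)).trans ((hC _ i).trans
      ((sigma_mk_sum_eq ih _).trans (congrArg (Sigma.mk (β := fun x ↦ ⋀[ℝ]^2 (E x)) (c a))
        ((sum_smul_sum_smul _ _ _ i).trans ?_))))
    rw [zpow_add_one]
    rfl
  | pred m ih =>
    have h : ∀ j, (⟨c (a + 2 * Real.pi * (-(m : ℤ) - 1 : ℤ)), ∑ k,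
        (C : Matrix (Fin 3) (Fin 3) ℝ) k j • Ω k (a + 2 * Real.pi * (-(m : ℤ) - 1 : ℤ))⟩ :
        Σ x, ⋀[ℝ]^2 (E x)) =
        ⟨c a, ∑ k, ((C ^ (-(m : ℤ)) : SO3) : Matrix (Fin 3) (Fin 3) ℝ) k j • Ω k a⟩ := fun j ↦ by
      rw [← ih, ← hC]
      exact sigma_mk_congr (Ω j) (by push_cast; ring)
    refine Eq.trans (congrArg (Sigma.mk (β := fun x ↦ ⋀[ℝ]^2 (E x)) _) ?_)
      ((sigma_mk_sum_eq h fun j ↦ ((C⁻¹ : SO3) : Matrix (Fin 3) (Fin 3) ℝ) j i).trans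
      (congrArg (Sigma.mk (β := fun x ↦ ⋀[ℝ]^2 (E x)) (c a))
        ((sum_smul_sum_smul _ _ _ i).trans ?_)))
    · refine Eq.symm ((sum_smul_sum_smul _ _ _ i).trans ?_)
      have h1 : (C : Matrix (Fin 3) (Fin 3) ℝ) * ((C⁻¹ : SO3) : Matrix (Fin 3) (Fin 3) ℝ) = 1 :=
        congrArg Subtype.val (mul_inv_cancel C)
      rw [h1]
      exact sum_one_smul (fun j ↦ Ω j _) i
    · rw [zpow_sub_one]
      rfl

variable [TopologicalSpace (TotalSpace R4 E)] [FiberBundle R4 E] [VectorBundle ℝ R4 E]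
  [ContMDiffVectorBundle ∞ R4 E torusModel] [IsContMDiffRiemannianBundle torusModel ∞ R4 E]

/-- The parallel transport along a whole number of turns around a closed curve, in a frame. -/
theorem transport_eq_zpow_mulVec {cov : CovariantDerivative torusModel R4 E}
    (hcov : cov.IsMetricCompatible) {o : ∀ x, Orientation ℝ (E x) (Fin 4)} {ε : ℤˣ}
    {c : ℝ → Torus} (hc : ∀ t, MDifferentiableAt 𝓘(ℝ, ℝ) torusModel c t) {x₀ : Torus}
    {α : Fin 3 → ⋀[ℝ]^2 (E x₀)} (hα : IsPositiveFrame (o x₀) ε α)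
    {F : Fin 3 → ∀ t, ⋀[ℝ]^2 (E (c t))} (hF : ∀ i, IsHorizontalOn cov o ε c (F i) univ)
    (hF0 : ∀ i, (⟨c 0, F i 0⟩ : Σ x, ⋀[ℝ]^2 (E x)) = ⟨x₀, α i⟩) {C : SO3}
    (hC : IsMonodromyMatrix c F C) (m : ℤ) {d : ℝ → Torus}
    (hd : d = fun t ↦ c (2 * Real.pi * m * t)) {Ω : ∀ t, ⋀[ℝ]^2 (E (d t))}
    (hΩ : IsHorizontalOn cov o ε d Ω (Icc 0 1)) {b : Fin 3 → ℝ}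
    (hb : (⟨d 0, Ω 0⟩ : Σ x, ⋀[ℝ]^2 (E x)) = ⟨x₀, ∑ i, b i • α i⟩) :
    (⟨d 1, Ω 1⟩ : Σ x, ⋀[ℝ]^2 (E x)) =
      ⟨x₀, ∑ i, ((C ^ m : SO3) : Matrix (Fin 3) (Fin 3) ℝ).mulVec b i • α i⟩ := by
  subst hd
  have hend : ∀ i, (⟨c (2 * Real.pi * m * 1), F i (2 * Real.pi * m * 1)⟩ : Σ x, ⋀[ℝ]^2 (E x)) =
      ⟨x₀, ∑ j, ((C ^ m : SO3) : Matrix (Fin 3) (Fin 3) ℝ) j i • α j⟩ := fun i ↦ by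
    rw [sigma_mk_congr (F i) (show 2 * Real.pi * m * 1 = 0 + 2 * Real.pi * m by ring), hC.zpow,
      sigma_mk_sum_eq hF0]
  have hstart : ∀ i, (⟨c (2 * Real.pi * m * 0), F i (2 * Real.pi * m * 0)⟩ :
      Σ x, ⋀[ℝ]^2 (E x)) = ⟨x₀, α i⟩ := fun i ↦ by
    rw [sigma_mk_congr (F i) (show 2 * Real.pi * m * 0 = 0 by ring), hF0]
  have hx : c (2 * Real.pi * m * 1) = x₀ := congrArg Sigma.fst (hend 0)
  obtain ⟨β, hβ⟩ : ∃ β : ⋀[ℝ]^2 (E x₀),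
      (⟨c (2 * Real.pi * m * 1), Ω 1⟩ : Σ x, ⋀[ℝ]^2 (E x)) = ⟨x₀, β⟩ := by
    exact exists_sigma_mk_eq hx _
  have hmem : β ∈ halfTwoVectors (o x₀) ε := by
    have h := (hΩ 1 (by simp)).1.1
    have aux : ∀ {x y : Torus} {u : ⋀[ℝ]^2 (E x)} {v : ⋀[ℝ]^2 (E y)},
        (⟨x, u⟩ : Σ x, ⋀[ℝ]^2 (E x)) = ⟨y, v⟩ → u ∈ halfTwoVectors (o x) ε →
          v ∈ halfTwoVectors (o y) ε := fun h hu ↦ by cases h; exact hu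
    exact aux hβ h
  -- Pairings of `Ω` with the horizontal frame are constant, which determines the end value without
  -- a uniqueness theorem for differential equations. In coordinates, the transpose of `C ^ m` maps
  -- the end to the start, and orthogonality inverts it.
  have hcoeff : ∀ i, ∑ j, ((C ^ m : SO3) : Matrix (Fin 3) (Fin 3) ℝ) j i *
      hatMetric β (α j) = b i := fun i ↦ by
    have h := hatMetric_eq_of_isHorizontalOn hcov (c := fun t ↦ c (2 * Real.pi * m * t))
      (fun t ↦ MDifferentiableAt.comp t (hc _) (by
        exact ((contDiff_const.mul contDiff_id).contMDiff (n := ∞)).mdifferentiableAt (by simp)))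
      (fun t ht ↦ (hΩ t ht).2)
      (fun t _ ↦ ((hF i) (2 * Real.pi * m * t) (mem_univ _)).2.comp_affine hc
        (2 * Real.pi * m) (Icc 0 1) t)
    rw [hatMetric_eq_of_sigma_mk_eq hβ (hend i), hatMetric_eq_of_sigma_mk_eq hb (hstart i)] at h
    simpa [hα.1] using h
  have hmul : ((C ^ m : SO3) : Matrix (Fin 3) (Fin 3) ℝ).mulVec b =
      fun j ↦ hatMetric β (α j) := by
    have hbT : b = ((C ^ m : SO3) : Matrix (Fin 3) (Fin 3) ℝ).transpose.mulVec
        fun j ↦ hatMetric β (α j) := funext fun i ↦ (hcoeff i).symm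
    have hO : ((C ^ m : SO3) : Matrix (Fin 3) (Fin 3) ℝ) *
        ((C ^ m : SO3) : Matrix (Fin 3) (Fin 3) ℝ).transpose = 1 :=
      (Matrix.mem_orthogonalGroup_iff (Fin 3) ℝ).mp
        (Matrix.mem_specialOrthogonalGroup_iff.mp (C ^ m).2).1
    rw [hbT, Matrix.mulVec_mulVec, hO, Matrix.one_mulVec]
  rw [hβ, hmul]
  exact congrArg (Sigma.mk (β := fun x ↦ ⋀[ℝ]^2 (E x)) x₀) (hα.sum_hatMetric_smul hmem)

theorem segmentCurve_eq_lineX {v w : ℝ × ℝ} (hv : pr v = pr (0, 0)) (hw : pr v = pr w)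
    (h : v.2 = w.2) : ∃ m : ℤ, segmentCurve v w = fun t ↦ lineX (2 * Real.pi * m * t) := by
  obtain ⟨m, hm⟩ := Circle.exp_eq_exp.mp (congrArg Prod.fst hw).symm
  refine ⟨m, funext fun t ↦ Prod.ext ?_ ?_⟩
  · have h0 : Circle.exp v.1 = 1 := by simpa [pr] using congrArg Prod.fst hv
    simp only [segmentCurve, lineX, pr, Prod.fst_add, Prod.smul_fst, Prod.fst_sub, hm,
      Circle.exp_add, h0, one_mul, smul_eq_mul]
    congr 1; ring
  · have h0 : Circle.exp v.2 = 1 := by simpa [pr] using congrArg Prod.snd hv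
    simp [segmentCurve, lineX, pr, ← h, h0]

theorem segmentCurve_eq_lineY {v w : ℝ × ℝ} (hv : pr v = pr (0, 0)) (hw : pr v = pr w)
    (h : v.1 = w.1) : ∃ m : ℤ, segmentCurve v w = fun t ↦ lineY (2 * Real.pi * m * t) := by
  obtain ⟨m, hm⟩ := Circle.exp_eq_exp.mp (congrArg Prod.snd hw).symm
  refine ⟨m, funext fun t ↦ Prod.ext ?_ ?_⟩
  · have h0 : Circle.exp v.1 = 1 := by simpa [pr] using congrArg Prod.fst hv
    simp [segmentCurve, lineY, pr, ← h, h0]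
  · have h0 : Circle.exp v.2 = 1 := by simpa [pr] using congrArg Prod.snd hv
    simp only [segmentCurve, lineY, pr, Prod.snd_add, Prod.smul_snd, Prod.snd_sub, hm,
      Circle.exp_add, h0, one_mul, smul_eq_mul]
    congr 1; ring

/-- The set `X(α)` is contained in the orbit of `α` under a topological holonomy group; hence this
group is infinite if the complexity is. -/
theorem IsTopologicalHolonomyGroup.infinite {cov : CovariantDerivative torusModel R4 E}
    (hcov : cov.IsMetricCompatible) {o : ∀ x, Orientation ℝ (E x) (Fin 4)} {ε : ℤˣ}
    {H : Subgroup SO3} (hH : IsTopologicalHolonomyGroup cov o ε H)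
    (hinf : HasInfiniteComplexity cov o ε) : Infinite H := by
  obtain ⟨α, Ωx, Ωy, C₁, C₂, hα, hx, hy, hC₁, hC₂, hHC⟩ := hH
  obtain ⟨β, hβ, hinf⟩ := hinf
  by_contra hfin
  rw [not_infinite_iff_finite] at hfin
  have hmem₁ : C₁ ∈ H := hHC ▸ Subgroup.subset_closure (by simp)
  have hmem₂ : C₂ ∈ H := hHC ▸ Subgroup.subset_closure (by simp)
  let b : Fin 3 → ℝ := fun i ↦ hatMetric β (α i)
  refine hinf ((Set.finite_range fun g : H ↦
    ∑ i, ((g : SO3) : Matrix (Fin 3) (Fin 3) ℝ).mulVec b i • α i).subset ?_)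
  rintro β' ⟨γ, τ, hτ0, hτ1, hτ⟩
  -- Induction along the vertices: each segment multiplies the group element on the left by a power
  -- of `C₁` or `C₂`.
  have key : ∀ i, pr (γ.vertex i) = pr (0, 0) ∧ ∃ g : H, τ i =
      ⟨pr (0, 0), ∑ i, ((g : SO3) : Matrix (Fin 3) (Fin 3) ℝ).mulVec b i • α i⟩ := by
    intro i
    induction i using Fin.induction with
    | zero =>
      refine ⟨by rw [γ.start], 1, hτ0.trans (congrArg (Sigma.mk (β := fun x ↦ ⋀[ℝ]^2 (E x)) _) ?_)⟩
      simpa [b] using hα.sum_hatMetric_smul hβ.1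
    | succ i ih =>
      obtain ⟨hv, g, hg⟩ := ih
      refine ⟨(γ.closed i).symm.trans hv, ?_⟩
      obtain ⟨Ω, hΩ, hp, hq⟩ := hτ i
      have hb := hp.symm.trans hg
      rcases γ.coord i with h | h
      · obtain ⟨m, hm⟩ := segmentCurve_eq_lineY hv (γ.closed i) h
        refine ⟨⟨C₂, hmem₂⟩ ^ m * g, hq.trans ((transport_eq_zpow_mulVec hcov
          mdifferentiableAt_lineY hα (fun i ↦ (hy i).1)
          (fun i ↦ congrArg (Sigma.mk _) (hy i).2) hC₂ m hm hΩ hb).trans ?_)⟩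
        rw [Matrix.mulVec_mulVec]
        rfl
      · obtain ⟨m, hm⟩ := segmentCurve_eq_lineX hv (γ.closed i) h
        refine ⟨⟨C₁, hmem₁⟩ ^ m * g, hq.trans ((transport_eq_zpow_mulVec hcov
          mdifferentiableAt_lineX hα (fun i ↦ (hx i).1)
          (fun i ↦ congrArg (Sigma.mk _) (hx i).2) hC₁ m hm hΩ hb).trans ?_)⟩
        rw [Matrix.mulVec_mulVec]
        rfl
  obtain ⟨-, g, hg⟩ := key (Fin.last _)
  exact ⟨g, (eq_of_heq (Sigma.mk.inj (hτ1.symm.trans hg)).2).symm⟩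

end Bundle

/-! ### Finitely generated periodic groups of matrices are finite -/

section Periodic

variable {n : Type*} [Fintype n] [DecidableEq n]

/-- The binomial expansion modulo `N` squared. If the power is 1, it expresses `q * N` as a
quadratic term in `N`. -/
theorem exists_one_add_pow_eq {A : Type*} [Ring A] (N : A) (q : ℕ) :
    ∃ S, (1 + N) ^ q = 1 + q * N + N * (N * S) := by
  induction q with
  | zero => exact ⟨0, by simp⟩
  | succ q ih =>
    obtain ⟨S, hS⟩ := ih
    refine ⟨q + S + S * N, ?_⟩
    rw [pow_succ, hS, Nat.cast_succ]
    have h : (q : A) * N = N * q := Nat.cast_comm q N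
    simp only [mul_add, add_mul, mul_one, one_mul, mul_assoc, h]
    abel

/-- A matrix of order prime to the residue characteristic which is congruent to the identity
modulo a maximal ideal is the identity. -/
theorem eq_one_of_pow_eq_one_of_sub_mem {R : Type*} [CommRing R] [IsDomain R]
    [IsNoetherianRing R] {m : Ideal R} (hm : m.IsMaximal) {q : ℕ} (hq : (q : R) ∉ m)
    {A : Matrix n n R} (hA : A ^ q = 1) (hmem : ∀ i j, (A - 1) i j ∈ m) : A = 1 := by
  obtain ⟨S, hS⟩ := exists_one_add_pow_eq (A - 1) q
  rw [add_sub_cancel, hA] at hS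
  have hrel : ∀ i j, (q : R) * (A - 1) i j = -((A - 1) * ((A - 1) * S)) i j := fun i j ↦ by
    have h : ((q : Matrix n n R) * (A - 1)) i j = (q : R) * (A - 1) i j := by
      rw [← nsmul_eq_mul, ← nsmul_eq_mul]; rfl
    rw [← h, ← Matrix.neg_apply]
    refine congrFun (congrFun (eq_neg_of_add_eq_zero_left ?_) i) j
    have := hS.symm
    rwa [add_assoc, add_eq_left] at this
  obtain ⟨y, b, hb, hy⟩ := hm.exists_inv hq
  -- With 1 = yq + b and b in `m`, an entry a equals y(qa) + ab. Here qa is quadratic in the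
  -- entries, so each step gains one power of `m`; Krull's intersection theorem then applies.
  have hpow : ∀ k, ∀ i j, (A - 1) i j ∈ m ^ k := by
    intro k
    induction k with
    | zero => simp
    | succ k ih =>
      intro i j
      have h1 : ((A - 1) * ((A - 1) * S)) i j ∈ m ^ (k + 1) := by
        rw [Matrix.mul_apply, pow_succ]
        refine Ideal.sum_mem _ fun l _ ↦ Ideal.mul_mem_mul (ih i l) ?_
        rw [Matrix.mul_apply]
        exact Ideal.sum_mem _ fun l' _ ↦ Ideal.mul_mem_right _ _ (hmem l l')
      have h2 : (A - 1) i j = y * ((q : R) * (A - 1) i j) + (A - 1) i j * b := by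
        linear_combination -(A - 1) i j * hy
      rw [h2, hrel]
      refine Ideal.add_mem _ (Ideal.mul_mem_left _ _ (neg_mem h1)) ?_
      rw [pow_succ]
      exact Ideal.mul_mem_mul (ih i j) hb
  have hzero : ∀ i j, (A - 1) i j = 0 := fun i j ↦ by
    have h : (A - 1) i j ∈ ⨅ k : ℕ, m ^ k := (Submodule.mem_iInf _).mpr fun k ↦ hpow k i j
    rwa [Ideal.iInf_pow_eq_bot_of_isDomain m hm.ne_top, Ideal.mem_bot] at h
  exact sub_eq_zero.mp (Matrix.ext hzero)

instance isJacobsonRing_int : IsJacobsonRing ℤ := by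
  refine isJacobsonRing_iff_prime_eq.mpr fun P hP ↦ ?_
  by_cases hbot : P = ⊥
  · subst hbot
    refine le_antisymm (fun x hx ↦ ?_) Ideal.le_jacobson
    rw [Ideal.mem_jacobson_bot] at hx
    -- Membership in the Jacobson radical makes x² + 1 a unit, hence ±1, so x = 0.
    rcases Int.isUnit_iff.mp (hx x) with h | h
    · simpa using h
    · nlinarith
  · have := hP.isMaximal hbot
    exact Ideal.jacobson_eq_self_of_isMaximal

theorem exists_nat_cast_eq_zero_of_finite_int {K : Type*} [Field K] [Module.Finite ℤ K] :
    ∃ p : ℕ, p ≠ 0 ∧ (p : K) = 0 := by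
  by_contra! h
  have hchar : CharZero K := by
    refine charZero_of_inj_zero fun p hp ↦ ?_
    by_contra hp0
    exact h p hp0 hp
  have hint : Algebra.IsIntegral ℤ K := inferInstance
  exact Int.not_isField (isField_of_isIntegral_of_isField (R := ℤ) (S := K)
    (RingHom.injective_int (algebraMap ℤ K)) (Field.toIsField K))

/-- The Nullstellensatz over the Jacobson ring ℤ makes the residue field a finite ℤ-module.
Characteristic zero would then make ℤ a field, so the module is torsion. -/
theorem finite_quotient_of_isMaximal {R : Type*} [CommRing R] [Algebra.FiniteType ℤ R]
    {m : Ideal R} (hm : m.IsMaximal) :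
    Finite (R ⧸ m) ∧ ∃ p : ℕ, p ≠ 0 ∧ (p : R) ∈ m := by
  let := Ideal.Quotient.field m
  have : Algebra.FiniteType ℤ (R ⧸ m) :=
    Algebra.FiniteType.of_surjective (Ideal.Quotient.mkₐ ℤ m) (Ideal.Quotient.mkₐ_surjective ℤ m)
  have hfin : Module.Finite ℤ (R ⧸ m) := finite_of_finite_type_of_isJacobsonRing ℤ (R ⧸ m)
  obtain ⟨p, hp, hpz⟩ := exists_nat_cast_eq_zero_of_finite_int (K := R ⧸ m)
  refine ⟨?_, p, hp, ?_⟩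
  · refine Module.finite_of_fg_torsion (R ⧸ m) fun x ↦ ?_
    refine ⟨⟨p, by simpa using hp⟩, ?_⟩
    simp [Submonoid.smul_def, hpz]
  · rw [← Ideal.Quotient.eq_zero_iff_mem, map_natCast, hpz]

/-- A Jacobson domain has zero as the intersection of its maximal ideals, so some `m₂` omits the
nonzero integer `p` in `m₁`. A prime in both ideals would either divide `p` or be coprime to it, and
both are impossible. -/
theorem exists_isMaximal_pair {R : Type*} [CommRing R] [IsDomain R] [CharZero R]
    [Algebra.FiniteType ℤ R] :
    ∃ m₁ m₂ : Ideal R, m₁.IsMaximal ∧ m₂.IsMaximal ∧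
      ∀ q : ℕ, q.Prime → (q : R) ∉ m₁ ∨ (q : R) ∉ m₂ := by
  obtain ⟨m₁, hm₁⟩ := Ideal.exists_maximal R
  obtain ⟨-, p, hp, hpm⟩ := finite_quotient_of_isMaximal hm₁
  have hJ : IsJacobsonRing R := isJacobsonRing_of_finiteType (A := ℤ)
  have hbot : (p : R) ∉ (⊥ : Ideal R).jacobson := by
    rw [hJ.out Ideal.isPrime_bot.isRadical, Ideal.mem_bot]
    exact_mod_cast hp
  rw [Ideal.jacobson, Submodule.mem_sInf] at hbot
  push Not at hbot
  obtain ⟨m₂, ⟨-, hm₂⟩, hpm₂⟩ := hbot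
  refine ⟨m₁, m₂, hm₁, hm₂, fun q hq ↦ ?_⟩
  by_contra! h
  by_cases hqp : q ∣ p
  · obtain ⟨k, rfl⟩ := hqp
    exact hpm₂ (by push_cast; exact Ideal.mul_mem_right _ _ h.2)
  · have hco : IsCoprime (q : ℤ) (p : ℤ) :=
      Nat.isCoprime_iff_coprime.mpr ((Nat.Prime.coprime_iff_not_dvd hq).mpr hqp)
    obtain ⟨a, b, hab⟩ := hco
    refine hm₁.ne_top ((Ideal.eq_top_iff_one _).mpr ?_)
    have h1 : (a : R) * q + b * p = 1 := by exact_mod_cast congrArg (Int.cast (R := R)) hab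
    rw [← h1]
    exact Ideal.add_mem _ (Ideal.mul_mem_left _ _ h.1) (Ideal.mul_mem_left _ _ hpm)

/-- Reduction modulo one maximal ideal may kill torsion of its residue characteristic. Reducing
modulo two ideals of different characteristics kills no element of prime order, so it embeds the
group in a finite set. -/
theorem finite_of_isOfFinOrder_of_injective {R : Type*} [CommRing R] [IsDomain R] [CharZero R]
    [Algebra.FiniteType ℤ R] {Γ : Type*} [Group Γ] (ρ : Γ →* Matrix n n R)
    (hρ : Function.Injective ρ) (htors : ∀ g : Γ, IsOfFinOrder g) : Finite Γ := by
  obtain ⟨m₁, m₂, hm₁, hm₂, hprime⟩ := exists_isMaximal_pair (R := R)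
  have := (finite_quotient_of_isMaximal hm₁).1
  have := (finite_quotient_of_isMaximal hm₂).1
  have : IsNoetherianRing R := Algebra.FiniteType.isNoetherianRing ℤ R
  let f : Γ →* Matrix n n (R ⧸ m₁) × Matrix n n (R ⧸ m₂) :=
    ((Ideal.Quotient.mk m₁).mapMatrix.toMonoidHom.comp ρ).prod
      ((Ideal.Quotient.mk m₂).mapMatrix.toMonoidHom.comp ρ)
  have : Finite (Matrix n n (R ⧸ m₁)) := inferInstanceAs (Finite (n → n → R ⧸ m₁))
  have : Finite (Matrix n n (R ⧸ m₂)) := inferInstanceAs (Finite (n → n → R ⧸ m₂))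
  refine Finite.of_injective f ((injective_iff_map_eq_one f).mpr fun g hg ↦ ?_)
  by_contra hne
  have hord : orderOf g ≠ 1 := fun h ↦ hne (orderOf_eq_one_iff.mp h)
  obtain ⟨q, hq, hdvd⟩ := Nat.exists_prime_and_dvd hord
  let k := g ^ (orderOf g / q)
  have hk : orderOf k = q := orderOf_pow_orderOf_div (htors g).orderOf_pos.ne' hdvd
  have hfk : f k = 1 := by rw [map_pow, hg, one_pow]
  have hkq : ρ k ^ q = 1 := by rw [← map_pow, ← hk, pow_orderOf_eq_one, map_one]
  have hone : ρ k = 1 := by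
    have hmem : ∀ m : Ideal R, (Ideal.Quotient.mk m).mapMatrix (ρ k) = 1 →
        ∀ i j, (ρ k - 1) i j ∈ m := fun m h i j ↦ by
      rw [← Ideal.Quotient.eq_zero_iff_mem]
      have h' : (Ideal.Quotient.mk m).mapMatrix (ρ k - 1) = 0 := by
        rw [map_sub, h, map_one, sub_self]
      exact congrFun (congrFun h' i) j
    rcases hprime q hq with h | h
    · exact eq_one_of_pow_eq_one_of_sub_mem hm₁ h hkq (hmem _ (congrArg Prod.fst hfk))
    · exact eq_one_of_pow_eq_one_of_sub_mem hm₂ h hkq (hmem _ (congrArg Prod.snd hfk))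
  have hk1 : k = 1 := hρ (hone.trans (map_one ρ).symm)
  rw [hk1, orderOf_one] at hk
  exact hq.one_lt.ne hk

/-- An infinite finitely generated group of rotations contains an element of infinite order. -/
theorem exists_not_isOfFinOrder {T : Set SO3} (hT : T.Finite)
    (hinf : Infinite (Subgroup.closure T)) : ∃ g ∈ Subgroup.closure T, ¬ IsOfFinOrder g := by
  by_contra! htors
  -- Entries of the generators suffice, since the inverse of a rotation is its transpose.
  let S : Set ℝ := ⋃ g ∈ T, Set.range fun p : Fin 3 × Fin 3 ↦ (g : Matrix (Fin 3) (Fin 3) ℝ) p.1 p.2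
  have hS : S.Finite := hT.biUnion fun g _ ↦ Set.finite_range _
  let R := Algebra.adjoin ℤ S
  have : Algebra.FiniteType ℤ R :=
    R.fg_iff_finiteType.mp ⟨hS.toFinset, by simp [R]⟩
  have hmem : ∀ g ∈ Subgroup.closure T, ∀ i j, (g : Matrix (Fin 3) (Fin 3) ℝ) i j ∈ R := by
    intro g hg
    induction hg using Subgroup.closure_induction with
    | mem x hx =>
      exact fun i j ↦ Algebra.subset_adjoin (Set.mem_biUnion hx ⟨(i, j), rfl⟩)
    | one =>
      intro i j
      change (1 : Matrix (Fin 3) (Fin 3) ℝ) i j ∈ R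
      rw [Matrix.one_apply]
      split_ifs
      exacts [one_mem R, zero_mem R]
    | mul x y _ _ hx hy =>
      intro i j
      change ((x : Matrix (Fin 3) (Fin 3) ℝ) * y) i j ∈ R
      rw [Matrix.mul_apply]
      exact sum_mem fun k _ ↦ mul_mem (hx i k) (hy k j)
    | inv x _ hx => exact fun i j ↦ hx j i
  let ρ : Subgroup.closure T →* Matrix (Fin 3) (Fin 3) R :=
    { toFun := fun g ↦ Matrix.of fun i j ↦ ⟨_, hmem g g.2 i j⟩
      map_one' := by
        ext i j
        simp [Matrix.one_apply]
        split_ifs <;> rfl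
      map_mul' := fun x y ↦ by
        ext i j
        simp [Matrix.mul_apply] }
  have hρ : Function.Injective ρ := fun x y h ↦ by
    ext i j
    exact congrArg Subtype.val (congrFun (congrFun h i) j)
  have := finite_of_isOfFinOrder_of_injective ρ hρ fun g ↦
    Submonoid.isOfFinOrder_coe.mp (htors g g.2)
  exact not_finite (Subgroup.closure T)

end Periodic

/-! ### Rotations and their axes -/

namespace SO3

/-- The action of a rotation on a vector. -/
def act (g : SO3) (u : Fin 3 → ℝ) : Fin 3 → ℝ := (g : Matrix (Fin 3) (Fin 3) ℝ).mulVec u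

theorem mul_act (g h : SO3) (u : Fin 3 → ℝ) : act (g * h) u = act g (act h u) :=
  (Matrix.mulVec_mulVec u (g : Matrix (Fin 3) (Fin 3) ℝ) (h : Matrix (Fin 3) (Fin 3) ℝ)).symm

theorem one_act (u : Fin 3 → ℝ) : act 1 u = u := Matrix.one_mulVec u

theorem act_smul (g : SO3) (r : ℝ) (u : Fin 3 → ℝ) : act g (r • u) = r • act g u :=
  Matrix.mulVec_smul _ _ _

theorem act_neg (g : SO3) (u : Fin 3 → ℝ) : act g (-u) = -act g u := Matrix.mulVec_neg _ _

theorem inv_act_act (g : SO3) (u : Fin 3 → ℝ) : act g⁻¹ (act g u) = u := by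
  rw [← mul_act, inv_mul_cancel, one_act]

theorem act_inv_act (g : SO3) (u : Fin 3 → ℝ) : act g (act g⁻¹ u) = u := by
  rw [← mul_act, mul_inv_cancel, one_act]

theorem mul_transpose (g : SO3) : (g : Matrix (Fin 3) (Fin 3) ℝ) *
    (g : Matrix (Fin 3) (Fin 3) ℝ).transpose = 1 :=
  (Matrix.mem_orthogonalGroup_iff (Fin 3) ℝ).mp (Matrix.mem_specialOrthogonalGroup_iff.mp g.2).1

theorem transpose_mul (g : SO3) : (g : Matrix (Fin 3) (Fin 3) ℝ).transpose *
    (g : Matrix (Fin 3) (Fin 3) ℝ) = 1 :=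
  mul_eq_one_comm.mp (mul_transpose g)

theorem det_eq_one (g : SO3) : (g : Matrix (Fin 3) (Fin 3) ℝ).det = 1 :=
  (Matrix.mem_specialOrthogonalGroup_iff.mp g.2).2

theorem act_dotProduct_act (g : SO3) (u : Fin 3 → ℝ) : act g u ⬝ᵥ act g u = u ⬝ᵥ u := by
  rw [act, Matrix.dotProduct_mulVec, Matrix.vecMul_mulVec, transpose_mul, Matrix.vecMul_one]

theorem act_eq_or_eq_neg {g : SO3} {u : Fin 3 → ℝ} {r : ℝ} (hu : u ≠ 0) (h : act g u = r • u) :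
    act g u = u ∨ act g u = -u := by
  have h1 := act_dotProduct_act g u
  have h0 : u ⬝ᵥ u ≠ 0 := fun h ↦ hu (dotProduct_self_eq_zero.mp h)
  rw [h, dotProduct_smul, smul_dotProduct, smul_eq_mul, smul_eq_mul, ← mul_assoc] at h1
  rcases mul_self_eq_one_iff.mp (mul_eq_right₀ h0 |>.mp h1) with rfl | rfl
  · exact Or.inl (by rw [h, one_smul])
  · exact Or.inr (by rw [h, neg_one_smul])

/-- The rotation of angle `θ` about the first coordinate axis. -/
def rot (θ : ℝ) : SO3 := ⟨rotMatrix θ, by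
  have h := Real.sin_sq_add_cos_sq θ
  rw [Matrix.mem_specialOrthogonalGroup_iff, Matrix.mem_orthogonalGroup_iff]
  constructor
  · ext i j
    fin_cases i <;> fin_cases j <;>
      simp [rotMatrix, Matrix.mul_apply, Fin.sum_univ_three] <;> linarith
  · simp [rotMatrix, Matrix.det_fin_three]; linarith⟩

theorem coe_rot (θ : ℝ) : (rot θ : Matrix (Fin 3) (Fin 3) ℝ) = rotMatrix θ := rfl

theorem rot_add (a b : ℝ) : rot (a + b) = rot a * rot b := by
  apply Subtype.ext
  rw [Submonoid.coe_mul, coe_rot, coe_rot, coe_rot]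
  ext i j
  fin_cases i <;> fin_cases j <;>
    simp [rotMatrix, Matrix.mul_apply, Fin.sum_univ_three, Real.cos_add, Real.sin_add] <;> ring

theorem rot_zero : rot 0 = 1 := by
  have h := rot_add 0 0
  rwa [add_zero, left_eq_mul] at h

theorem rot_pow (θ : ℝ) (n : ℕ) : rot θ ^ n = rot (n * θ) := by
  induction n with
  | zero => simp [rot_zero]
  | succ n ih => rw [pow_succ, ih, ← rot_add]; push_cast; ring_nf

theorem rot_eq_one_iff {θ : ℝ} : rot θ = 1 ↔ Real.cos θ = 1 := by
  constructor
  · intro h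
    have := congrFun (congrFun (congrArg Subtype.val h) 1) 1
    simpa [coe_rot, rotMatrix] using this
  · intro h
    have hs : Real.sin θ = 0 := by
      have := Real.sin_sq_add_cos_sq θ
      rw [h] at this
      exact pow_eq_zero_iff (two_ne_zero) |>.mp (by linarith)
    apply Subtype.ext
    rw [coe_rot, rotMatrix, h, hs]
    ext i j
    fin_cases i <;> fin_cases j <;> simp

theorem isRotationAngle_iff {C : SO3} {θ : ℝ} :
    IsRotationAngle C θ ↔ ∃ V : SO3, C = V * rot θ * V⁻¹ :=
  exists_congr fun _ ↦ ⟨fun h ↦ Subtype.ext h, fun h ↦ congrArg Subtype.val h⟩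

theorem exists_act_single_eq {u : Fin 3 → ℝ} (hu : u ≠ 0) :
    ∃ V : SO3, ∃ r : ℝ, r ≠ 0 ∧ act V (Pi.single 0 r) = u := by
  obtain ⟨w, hw, huw⟩ : ∃ w : Fin 3 → ℝ, w ≠ 0 ∧ u ⬝ᵥ w = 0 := by
    by_cases h : u 0 = 0 ∧ u 1 = 0
    · exact ⟨![1, 0, 0], fun h' ↦ by simpa using congrFun h' 0, by
        simp [dotProduct, Fin.sum_univ_three, h]⟩
    · refine ⟨![-u 1, u 0, 0], fun h' ↦ h ⟨by simpa using congrFun h' 1, by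
        simpa using congrFun h' 0⟩, ?_⟩
      simp [dotProduct, Fin.sum_univ_three]; ring
  have normalize : ∀ x : Fin 3 → ℝ, x ≠ 0 → 0 < √(x ⬝ᵥ x) ∧ x ⬝ᵥ x = √(x ⬝ᵥ x) * √(x ⬝ᵥ x) :=
    fun x hx ↦ by
      have hpos : 0 < x ⬝ᵥ x := lt_of_le_of_ne (by
        simpa using dotProduct_star_self_nonneg x)
        fun h ↦ hx (dotProduct_self_eq_zero.mp h.symm)
      exact ⟨Real.sqrt_pos.mpr hpos, (Real.mul_self_sqrt hpos.le).symm⟩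
  obtain ⟨hr, hr2⟩ := normalize u hu
  obtain ⟨hs, hs2⟩ := normalize w hw
  set r := √(u ⬝ᵥ u)
  set s := √(w ⬝ᵥ w)
  let a := r⁻¹ • u
  let b := s⁻¹ • w
  have haa : a ⬝ᵥ a = 1 := by
    simp only [a, dotProduct_smul, smul_dotProduct, smul_eq_mul, hr2]; field_simp
  have hbb : b ⬝ᵥ b = 1 := by
    simp only [b, dotProduct_smul, smul_dotProduct, smul_eq_mul, hs2]; field_simp
  have hab : a ⬝ᵥ b = 0 := by simp [a, b, dotProduct_smul, smul_dotProduct, huw]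
  let M : Matrix (Fin 3) (Fin 3) ℝ := Matrix.of ![a, b, crossProduct a b]
  have hcc : crossProduct a b ⬝ᵥ crossProduct a b = 1 := by
    rw [cross_dot_cross, haa, hbb, hab]; ring
  have hMM : M * M.transpose = 1 := by
    have hdot : ∀ i j, (M * M.transpose) i j =
        ![a, b, crossProduct a b] i ⬝ᵥ ![a, b, crossProduct a b] j := fun i j ↦ rfl
    ext i j
    rw [hdot]
    fin_cases i <;> fin_cases j <;>
      simp [haa, hbb, hab, hcc, dot_self_cross, dot_cross_self, dotProduct_comm b a,
        dotProduct_comm (crossProduct a b)]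
  have hdet : M.det = 1 := by
    have h : M.det = a ⬝ᵥ crossProduct b (crossProduct a b) := (triple_product_eq_det _ _ _).symm
    rw [h, triple_product_permutation, triple_product_permutation, hcc]
  have hMT : M.transpose ∈ Matrix.specialOrthogonalGroup (Fin 3) ℝ := by
    rw [Matrix.mem_specialOrthogonalGroup_iff, Matrix.mem_orthogonalGroup_iff]
    exact ⟨mul_eq_one_comm.mp hMM, by rw [Matrix.det_transpose, hdet]⟩
  refine ⟨⟨M.transpose, hMT⟩, r, hr.ne', ?_⟩
  ext i
  simp [act, M, a, Matrix.mulVec_single]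
  field_simp

theorem eq_rot_of_act_single {g : SO3} {r : ℝ} (hr : r ≠ 0)
    (h : act g (Pi.single 0 r) = Pi.single 0 r) : ∃ θ, g = rot θ := by
  set M := (g : Matrix (Fin 3) (Fin 3) ℝ) with hM
  have hc : ∀ i, M i 0 * r = (Pi.single 0 r : Fin 3 → ℝ) i := fun i ↦ by
    rw [← congrFun h i]; simp [act, hM, Matrix.mulVec_single, mul_comm]
  have h00 : M 0 0 = 1 := by simpa [hr] using hc 0
  have h10 : M 1 0 = 0 := by simpa [hr] using hc 1
  have h20 : M 2 0 = 0 := by simpa [hr] using hc 2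
  have hrow : ∀ i j, M i 0 * M j 0 + M i 1 * M j 1 + M i 2 * M j 2 =
      (1 : Matrix (Fin 3) (Fin 3) ℝ) i j := fun i j ↦ by
    rw [← mul_transpose g, Matrix.mul_apply, Fin.sum_univ_three]; rfl
  have hr0 := hrow 0 0
  have hr1 := hrow 1 1
  have hr2 := hrow 2 2
  simp only [h00, h10, h20, Matrix.one_apply_eq] at hr0 hr1 hr2
  have h01 : M 0 1 = 0 := by nlinarith [sq_nonneg (M 0 1), sq_nonneg (M 0 2)]
  have h02 : M 0 2 = 0 := by nlinarith [sq_nonneg (M 0 1), sq_nonneg (M 0 2)]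
  have hdet := det_eq_one g
  rw [← hM, Matrix.det_fin_three, h00, h10, h20, h01, h02] at hdet
  -- For the remaining 2×2 block this sum is the sum of squared entries minus twice the determinant,
  -- that is 2 - 2.
  have hsum : (M 1 1 - M 2 2) ^ 2 + (M 1 2 + M 2 1) ^ 2 = 0 := by
    linear_combination hr1 + hr2 - 2 * hdet
  have hd : M 2 2 = M 1 1 := by nlinarith [sq_nonneg (M 1 1 - M 2 2), sq_nonneg (M 1 2 + M 2 1)]
  have he : M 1 2 = -M 2 1 := by nlinarith [sq_nonneg (M 1 1 - M 2 2), sq_nonneg (M 1 2 + M 2 1)]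
  obtain ⟨θ, hcos, hsin⟩ : ∃ θ, Real.cos θ = M 1 1 ∧ Real.sin θ = M 2 1 := by
    have hnorm : ‖(⟨M 1 1, M 2 1⟩ : ℂ)‖ = 1 := by
      rw [Complex.norm_eq_sqrt_sq_add_sq, Real.sqrt_eq_one]
      rw [he] at hr1
      simp only
      linarith
    have hne : (⟨M 1 1, M 2 1⟩ : ℂ) ≠ 0 := fun h ↦ by simp [h] at hnorm
    refine ⟨Complex.arg ⟨M 1 1, M 2 1⟩, ?_, ?_⟩
    · rw [Complex.cos_arg hne, hnorm, div_one]
    · rw [Complex.sin_arg, hnorm, div_one]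
  refine ⟨θ, Subtype.ext ?_⟩
  rw [coe_rot, rotMatrix, hcos, hsin]
  ext i j
  fin_cases i <;> fin_cases j <;> simp [← hM, h00, h10, h20, h01, h02, hd, he]

/-- The rotations which fix a given vector have a common normal form. -/
theorem exists_common_frame {u : Fin 3 → ℝ} (hu : u ≠ 0) :
    ∃ V : SO3, ∃ r : ℝ, r ≠ 0 ∧ act V (Pi.single 0 r) = u ∧
      ∀ g, act g u = u → ∃ θ, g = V * rot θ * V⁻¹ := by
  obtain ⟨V, r, hr, hV⟩ := exists_act_single_eq hu
  refine ⟨V, r, hr, hV, fun g hg ↦ ?_⟩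
  obtain ⟨θ, hθ⟩ := eq_rot_of_act_single (g := V⁻¹ * g * V) hr (by
    rw [mul_act, mul_act, hV, hg, ← hV, inv_act_act])
  exact ⟨θ, by rw [← hθ]; group⟩

theorem commute_of_act_eq {u : Fin 3 → ℝ} (hu : u ≠ 0) {g h : SO3} (hg : act g u = u)
    (hh : act h u = u) : Commute g h := by
  obtain ⟨V, -, -, -, hV⟩ := exists_common_frame hu
  obtain ⟨a, rfl⟩ := hV g hg
  obtain ⟨b, rfl⟩ := hV h hh
  have hab : rot a * rot b = rot b * rot a := by rw [← rot_add, ← rot_add, add_comm]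
  rw [commute_iff_eq, conj_mul, conj_mul, hab]

theorem exists_smul_eq_of_act_eq {u v : Fin 3 → ℝ} (hu : u ≠ 0) {g : SO3} (hg : g ≠ 1)
    (hgu : act g u = u) (hgv : act g v = v) : ∃ r : ℝ, v = r • u := by
  obtain ⟨V, r, hr, hVu, hV⟩ := exists_common_frame hu
  obtain ⟨θ, hθ⟩ := hV g hgu
  set x := act V⁻¹ v with hx
  have hfix : act (rot θ) x = x := by
    have : rot θ = V⁻¹ * g * V := by rw [hθ]; group
    rw [this, hx, ← mul_act, mul_assoc, mul_inv_cancel, mul_one, mul_act, hgv]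
  have hcos : Real.cos θ ≠ 1 := fun h ↦ hg (by rw [hθ, rot_eq_one_iff.mpr h]; group)
  have h1 := congrFun hfix 1
  have h2 := congrFun hfix 2
  simp [act, coe_rot, rotMatrix, Matrix.mulVec, dotProduct, Fin.sum_univ_three] at h1 h2
  have hsq := Real.sin_sq_add_cos_sq θ
  -- This is the determinant of the rotation minus the identity on the plane orthogonal to the axis.
  have hpos : 0 < 2 - 2 * Real.cos θ := by
    have := lt_of_le_of_ne (Real.cos_le_one θ) hcos
    linarith
  have hx1 : x 1 = 0 := by
    have : (2 - 2 * Real.cos θ) * x 1 = 0 := by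
      linear_combination (Real.cos θ - 1) * h1 + Real.sin θ * h2 - x 1 * hsq
    exact (mul_eq_zero.mp this).resolve_left hpos.ne'
  have hx2 : x 2 = 0 := by
    have : (2 - 2 * Real.cos θ) * x 2 = 0 := by
      linear_combination (Real.cos θ - 1) * h2 - Real.sin θ * h1 - x 2 * hsq
    exact (mul_eq_zero.mp this).resolve_left hpos.ne'
  have hxs : x = (x 0 / r) • Pi.single 0 r := by
    ext i; fin_cases i <;> simp [hx1, hx2, hr]
  refine ⟨x 0 / r, ?_⟩
  rw [← hVu, ← act_smul, ← hxs, hx, act_inv_act]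

/-- Euler's theorem: orthogonality and determinant 1 give det(M - 1) = det(1 - M), which in odd
dimension is -det(M - 1). -/
theorem exists_act_eq (g : SO3) : ∃ u : Fin 3 → ℝ, u ≠ 0 ∧ act g u = u := by
  set M := (g : Matrix (Fin 3) (Fin 3) ℝ) with hM
  have hdet : (M - 1).det = 0 := by
    have h1 : M - 1 = M * (1 - M).transpose := by
      rw [Matrix.transpose_sub, Matrix.transpose_one, mul_sub, mul_transpose, mul_one]
    have h2 : (M - 1).det = (1 - M).det := by
      conv_lhs => rw [h1]
      rw [Matrix.det_mul, det_eq_one, one_mul, Matrix.det_transpose]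
    have h3 : (1 - M).det = -(M - 1).det := by
      rw [← neg_sub, Matrix.det_neg]; simp [pow_succ]
    linarith
  obtain ⟨u, hu, h⟩ := Matrix.exists_mulVec_eq_zero_iff.mpr hdet
  refine ⟨u, hu, ?_⟩
  rwa [Matrix.sub_mulVec, Matrix.one_mulVec, sub_eq_zero] at h

/-- A rotation which reverses a vector is a half-turn. -/
theorem sq_eq_one_of_act_eq_neg {g : SO3} {u : Fin 3 → ℝ} (hu : u ≠ 0) (hg : act g u = -u) :
    g ^ 2 = 1 := by
  by_contra hne
  obtain ⟨b, hb, hgb⟩ := exists_act_eq g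
  -- Both `u` and the fixed vector `b` of `g` are fixed by `g ^ 2`, so they are parallel and `g`
  -- fixes `u`.
  obtain ⟨r, hr⟩ := exists_smul_eq_of_act_eq hb hne
    (by rw [pow_two, mul_act, hgb, hgb]) (v := u)
    (by rw [pow_two, mul_act, hg, act_neg, hg, neg_neg])
  rw [hr, act_smul, hgb] at hg
  exact hu (by rw [hr]; exact self_eq_neg.mp hg)

theorem isAxisVector_iff {C : SO3} {u : EuclideanSpace ℝ (Fin 3)} :
    IsAxisVector C u ↔ act C u.ofLp = u.ofLp ∧ u.ofLp ≠ 0 := by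
  rw [IsAxisVector, Module.End.hasEigenvector_iff, Module.End.mem_eigenspace_iff, one_smul]
  refine and_congr ?_ ?_
  · rw [← (WithLp.ofLp_injective 2).eq_iff]
    rfl
  · exact not_congr (WithLp.ofLp_eq_zero 2).symm

/-- A rotation of infinite order has an eigenvalue `exp (i ψ π)` with `ψ` irrational. -/
theorem exists_hasEigenvalue_irrational {g : SO3} (hg : ¬ IsOfFinOrder g) :
    ∃ (ζ : ℂ) (ψ : ℝ), Module.End.HasEigenvalue
      (Matrix.toLin' ((g : Matrix (Fin 3) (Fin 3) ℝ).map (algebraMap ℝ ℂ))) ζ ∧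
    ζ ≠ 1 ∧ Irrational ψ ∧ ζ = Complex.exp (Complex.I * ψ * Real.pi) := by
  obtain ⟨u, hu, hgu⟩ := exists_act_eq g
  obtain ⟨V, -, -, -, hV⟩ := exists_common_frame hu
  obtain ⟨θ, hθ⟩ := hV g hgu
  have hcast : ((θ / Real.pi : ℝ) : ℂ) * Real.pi = θ := by
    rw [← Complex.ofReal_mul, div_mul_cancel₀ _ Real.pi_ne_zero]
  have hirr : Irrational (θ / Real.pi) := by
    rintro ⟨q, hq⟩
    refine hg (isOfFinOrder_iff_pow_eq_one.mpr ⟨2 * q.den, by positivity, ?_⟩)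
    rw [hθ, conj_pow, rot_pow, rot_eq_one_iff.mpr, mul_one, mul_inv_cancel]
    rw [Real.cos_eq_one_iff]
    refine ⟨q.num, ?_⟩
    have hθq : θ = q * Real.pi := by rw [hq]; field_simp
    have hqd : (q : ℝ) * q.den = q.num := by exact_mod_cast Rat.mul_den_eq_num q
    rw [hθq]
    push_cast
    linear_combination -2 * Real.pi * hqd
  refine ⟨Complex.exp (θ * Complex.I), θ / Real.pi, ?_, ?_, hirr, ?_⟩
  · let φ := (algebraMap ℝ ℂ).mapMatrix (m := Fin 3)
    -- The eigenvector of the standard rotation for the eigenvalue exp(iθ).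
    let w : Fin 3 → ℂ := ![0, 1, -Complex.I]
    have hcoe : (g : Matrix (Fin 3) (Fin 3) ℝ).map (algebraMap ℝ ℂ) =
        φ V * φ (rotMatrix θ) * φ (V : Matrix (Fin 3) (Fin 3) ℝ).transpose := by
      rw [← map_mul, ← map_mul]
      exact congrArg (fun h : SO3 ↦ φ h) hθ
    have hVV : φ (V : Matrix (Fin 3) (Fin 3) ℝ).transpose * φ V = 1 := by
      rw [← map_mul, transpose_mul, map_one]
    have hw : (φ (rotMatrix θ)).mulVec w = Complex.exp (θ * Complex.I) • w := by
      rw [Complex.exp_mul_I]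
      ext i
      fin_cases i
      · simp [φ, w, rotMatrix, Matrix.mulVec, dotProduct, Fin.sum_univ_three]
      · simp [φ, w, rotMatrix, Matrix.mulVec, dotProduct, Fin.sum_univ_three]
      · simp [φ, w, rotMatrix, Matrix.mulVec, dotProduct, Fin.sum_univ_three]
        linear_combination Complex.sin θ * Complex.I_mul_I
    refine Module.End.hasEigenvalue_of_hasEigenvector (x := (φ V).mulVec w)
      (Module.End.hasEigenvector_iff.mpr ⟨Module.End.mem_eigenspace_iff.mpr ?_, fun h0 ↦ ?_⟩)
    · rw [Matrix.toLin'_apply, hcoe, Matrix.mulVec_mulVec, mul_assoc, hVV, mul_one,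
        ← Matrix.mulVec_mulVec, hw, Matrix.mulVec_smul]
    · have h1 : w = 0 := by
        rw [← Matrix.one_mulVec w, ← hVV, ← Matrix.mulVec_mulVec, h0, Matrix.mulVec_zero]
      simpa [w] using congrFun h1 1
  · intro h
    obtain ⟨k, hk⟩ := Complex.exp_eq_one_iff.mp h
    refine hirr ⟨2 * k, ?_⟩
    have h' : (θ : ℂ) = k * (2 * Real.pi) :=
      mul_right_cancel₀ Complex.I_ne_zero (by rw [hk]; ring)
    have hθk : θ = k * (2 * Real.pi) := by exact_mod_cast h'
    rw [hθk]
    have := Real.pi_ne_zero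
    push_cast
    field_simp
  · rw [mul_assoc, hcast, mul_comm]

end SO3

/-! ### Groups with a halved angle -/

/-- The relations make `B` invert `A`, so every element is a power of `A` or such a power times `B`;
the latter square to 1. -/
theorem isOfFinOrder_of_mem_closure_pair {Γ : Type*} [Group Γ] {A B : Γ} (hA : IsOfFinOrder A)
    (hB : B ^ 2 = 1) (hBA : (B * A) ^ 2 = 1) {x : Γ} (hx : x ∈ Subgroup.closure {A, B}) :
    IsOfFinOrder x := by
  have hBB : B * B = 1 := by rw [← pow_two, hB]
  have hBinv : B⁻¹ = B := inv_eq_of_mul_eq_one_left hBB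
  have hconj : ∀ k : ℤ, B * A ^ k = A ^ (-k) * B := fun k ↦ by
    have h1 : B * A * B⁻¹ = A⁻¹ := by
      rw [hBinv, eq_inv_iff_mul_eq_one, mul_assoc, ← pow_two, hBA]
    have h2 : B * A ^ k * B⁻¹ = A ^ (-k) := by rw [← conj_zpow, h1, inv_zpow']
    rw [← h2, inv_mul_cancel_right]
  have hform : ∃ k : ℤ, x = A ^ k ∨ x = A ^ k * B := by
    induction hx using Subgroup.closure_induction with
    | mem y hy =>
      rcases hy with rfl | rfl
      · exact ⟨1, Or.inl (zpow_one _).symm⟩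
      · exact ⟨0, Or.inr (by simp)⟩
    | one => exact ⟨0, Or.inl (by simp)⟩
    | mul y z _ _ hy hz =>
      obtain ⟨k, rfl | rfl⟩ := hy <;> obtain ⟨l, rfl | rfl⟩ := hz
      · exact ⟨k + l, Or.inl (zpow_add A k l).symm⟩
      · exact ⟨k + l, Or.inr (by rw [zpow_add, mul_assoc])⟩
      · exact ⟨k + -l, Or.inr (by rw [mul_assoc, hconj, zpow_add, mul_assoc])⟩
      · refine ⟨k + -l, Or.inl ?_⟩
        rw [mul_assoc, ← mul_assoc B, hconj, mul_assoc _ B, hBB, mul_one, zpow_add]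
    | inv y _ hy =>
      obtain ⟨k, rfl | rfl⟩ := hy
      · exact ⟨-k, Or.inl (zpow_neg A k).symm⟩
      · exact ⟨k, Or.inr (by rw [mul_inv_rev, hBinv, ← zpow_neg, hconj, neg_neg])⟩
  obtain ⟨k, rfl | rfl⟩ := hform
  · exact hA.zpow
  · refine isOfFinOrder_iff_pow_eq_one.mpr ⟨2, two_pos, ?_⟩
    rw [pow_two, mul_assoc, ← mul_assoc B, hconj, mul_assoc _ B, hBB, mul_one, ← zpow_add,
      add_neg_cancel, zpow_zero]

open SO3

theorem IsRotationAngle.pow_eq_one_iff {C : SO3} {θ : ℝ} (h : IsRotationAngle C θ) (n : ℕ) :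
    C ^ n = 1 ↔ ∃ k : ℤ, (k : ℝ) * (2 * Real.pi) = n * θ := by
  obtain ⟨V, rfl⟩ := isRotationAngle_iff.mp h
  rw [conj_pow, rot_pow, conj_eq_one_iff, rot_eq_one_iff, Real.cos_eq_one_iff]

theorem IsRotationAngle.ne_one {C : SO3} {θ : ℝ} (h : IsRotationAngle C θ)
    (hθ : θ ∈ Ioo 0 (2 * Real.pi)) : C ≠ 1 := fun h1 ↦ by
  obtain ⟨k, hk⟩ := (h.pow_eq_one_iff 1).mp (by rw [h1, one_pow])
  rw [Nat.cast_one, one_mul] at hk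
  rw [← hk] at hθ
  have hk0 : (0 : ℝ) < k := pos_of_mul_pos_left hθ.1 (by positivity)
  have hk1 : (k : ℝ) < 1 := by
    have := hθ.2
    by_contra! h
    nlinarith [Real.pi_pos]
  have h0 : 0 < k := by exact_mod_cast hk0
  have h1 : k < 1 := by exact_mod_cast hk1
  omega

theorem IsRotationAngle.eq_pi {C : SO3} {θ : ℝ} (h : IsRotationAngle C θ)
    (hθ : θ ∈ Ioo 0 (2 * Real.pi)) (h2 : C ^ 2 = 1) : θ = Real.pi := by
  obtain ⟨k, hk⟩ := (h.pow_eq_one_iff 2).mp h2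
  push_cast at hk
  have hθk : θ = k * Real.pi := by linarith
  rw [hθk] at hθ
  have hk0 : (0 : ℝ) < k := pos_of_mul_pos_left hθ.1 Real.pi_pos.le
  have hk1 : (k : ℝ) < 2 := lt_of_mul_lt_mul_right hθ.2 Real.pi_pos.le
  have h0 : 0 < k := by exact_mod_cast hk0
  have h1 : k < 2 := by exact_mod_cast hk1
  obtain rfl : k = 1 := by omega
  simpa using hθk

theorem IsRotationAngle.isOfFinOrder_of_half {C A : SO3} {θ : ℝ} (hC : IsRotationAngle C θ)
    (hA : IsRotationAngle A (θ / 2)) (hfin : IsOfFinOrder C) : IsOfFinOrder A := by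
  obtain ⟨n, hn, hCn⟩ := isOfFinOrder_iff_pow_eq_one.mp hfin
  obtain ⟨k, hk⟩ := (hC.pow_eq_one_iff n).mp hCn
  refine isOfFinOrder_iff_pow_eq_one.mpr ⟨2 * n, by positivity, (hA.pow_eq_one_iff _).mpr ⟨k, ?_⟩⟩
  rw [hk]
  push_cast
  ring

/-- A common axis would make the angle 0 or π, both outside (0, π/2]. -/
theorem IsAxisAngle.not_act_eq {C₁ C₂ : SO3} {φ : ℝ} (h : IsAxisAngle C₁ C₂ φ) (h₁ : C₁ ≠ 1)
    (h₂ : C₂ ≠ 1) {u : Fin 3 → ℝ} (hu : u ≠ 0) (hu₁ : act C₁ u = u) : act C₂ u ≠ u := by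
  intro hu₂
  obtain ⟨hφ, a, b, ha, hb, hab⟩ := h
  rw [isAxisVector_iff] at ha hb
  obtain ⟨r, hr⟩ := exists_smul_eq_of_act_eq hu h₁ hu₁ ha.1
  obtain ⟨s, hs⟩ := exists_smul_eq_of_act_eq hu h₂ hu₂ hb.1
  have hr0 : r ≠ 0 := fun h ↦ ha.2 (by rw [hr, h, zero_smul])
  have hs0 : s ≠ 0 := fun h ↦ hb.2 (by rw [hs, h, zero_smul])
  have hba : b = (s / r) • a := by
    apply WithLp.ofLp_injective 2
    rw [WithLp.ofLp_smul, hr, hs, smul_smul, div_mul_cancel₀ _ hr0]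
  have ha0 : a ≠ 0 := fun h ↦ ha.2 (by rw [h]; rfl)
  have hpi := Real.pi_pos
  rcases lt_or_gt_of_ne (div_ne_zero hs0 hr0) with hneg | hpos
  · rw [hba, InnerProductGeometry.angle_smul_right_of_neg _ _ hneg,
      InnerProductGeometry.angle_self_neg_of_nonzero ha0] at hab
    linarith [hφ.2]
  · rw [hba, InnerProductGeometry.angle_smul_right_of_pos _ _ hpos,
      InnerProductGeometry.angle_self ha0] at hab
    linarith [hφ.1]

/-- A group with a halved angle which preserves a line is periodic. -/
theorem IsHalvedAngleGroup.isOfFinOrder_of_preserves_line {G : Subgroup SO3}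
    (hG : IsHalvedAngleGroup G) {u : Fin 3 → ℝ} (hu : u ≠ 0)
    (hline : ∀ x ∈ G, act x u = u ∨ act x u = -u) : ∀ x ∈ G, IsOfFinOrder x := by
  obtain ⟨G₀, C₁, C₂, C₁', C₂', θ₁, θ₂, θ₁', θ₂', φ, hfin, -, hG₀, hθ₁, hθ₂, hC₁, hC₂, -, hhalf,
    hC₁', hC₂', hφ, rfl⟩ := hG
  have hord : ∀ C ∈ G₀, IsOfFinOrder C := fun C hC ↦
    Submonoid.isOfFinOrder_coe.mpr (isOfFinOrder_of_finite (⟨C, hC⟩ : G₀))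
  have hord₁ : IsOfFinOrder C₁ := hord _ (hG₀ ▸ Subgroup.subset_closure (by simp))
  have hord₂ : IsOfFinOrder C₂ := hord _ (hG₀ ▸ Subgroup.subset_closure (by simp))
  have hθ₁' : θ₁' ∈ Ioo 0 (2 * Real.pi) := by
    rcases hhalf with ⟨rfl, -⟩ | ⟨rfl, -⟩
    · exact ⟨by linarith [hθ₁.1], by linarith [hθ₁.1, hθ₁.2]⟩
    · exact hθ₁
  have hθ₂' : θ₂' ∈ Ioo 0 (2 * Real.pi) := by
    rcases hhalf with ⟨-, rfl⟩ | ⟨-, rfl⟩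
    · exact hθ₂
    · exact ⟨by linarith [hθ₂.1], by linarith [hθ₂.1, hθ₂.2]⟩
  have hdihedral : ∀ A B : SO3, IsOfFinOrder A → act A u = u → act B u = -u →
      ∀ x ∈ Subgroup.closure {A, B}, IsOfFinOrder x := fun A B hA hAu hBu x hx ↦
    isOfFinOrder_of_mem_closure_pair hA (sq_eq_one_of_act_eq_neg hu hBu)
      (sq_eq_one_of_act_eq_neg hu (by rw [mul_act, hAu, hBu])) hx
  -- Both fixing `u` contradicts the distinct axes. A reversing generator has angle π, which a
  -- halved angle below π excludes; the dihedral case remains.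
  rcases hline C₁' (Subgroup.subset_closure (by simp)) with h₁ | h₁ <;>
    rcases hline C₂' (Subgroup.subset_closure (by simp)) with h₂ | h₂
  · exact absurd h₂ (hφ.not_act_eq (hC₁'.ne_one hθ₁') (hC₂'.ne_one hθ₂') hu h₁)
  · have hpi := hC₂'.eq_pi hθ₂' (sq_eq_one_of_act_eq_neg hu h₂)
    rcases hhalf with ⟨rfl, -⟩ | ⟨-, rfl⟩
    · exact hdihedral _ _ (hC₁.isOfFinOrder_of_half hC₁' hord₁) h₁ h₂
    · linarith [hθ₂.2]
  · have hpi := hC₁'.eq_pi hθ₁' (sq_eq_one_of_act_eq_neg hu h₁)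
    rcases hhalf with ⟨rfl, -⟩ | ⟨-, rfl⟩
    · linarith [hθ₁.2]
    · rw [Set.pair_comm]
      exact hdihedral _ _ (hC₂.isOfFinOrder_of_half hC₂' hord₂) h₂ h₁
  · have hpi₁ := hC₁'.eq_pi hθ₁' (sq_eq_one_of_act_eq_neg hu h₁)
    have hpi₂ := hC₂'.eq_pi hθ₂' (sq_eq_one_of_act_eq_neg hu h₂)
    rcases hhalf with ⟨rfl, -⟩ | ⟨-, rfl⟩
    · linarith [hθ₁.2]
    · linarith [hθ₂.2]

/-! ### Groups of rotations with an element of infinite order -/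

theorem not_isOfFinOrder_pow {Γ : Type*} [Group Γ] {g : Γ} (hg : ¬ IsOfFinOrder g) {n : ℕ}
    (hn : n ≠ 0) : g ^ n ≠ 1 :=
  fun h ↦ hg (isOfFinOrder_iff_pow_eq_one.mpr ⟨n, Nat.pos_of_ne_zero hn, h⟩)

/-- If the squares in a group of rotations commute, then the group preserves the axis of each of
its elements of infinite order. -/
theorem act_eq_or_eq_neg_of_commute_sq {G : Subgroup SO3}
    (hcomm : ∀ x ∈ G, ∀ y ∈ G, Commute (x ^ 2) (y ^ 2)) {g : SO3} (hgG : g ∈ G)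
    (hg : ¬ IsOfFinOrder g) {u : Fin 3 → ℝ} (hu : u ≠ 0) (hgu : act g u = u) {x : SO3}
    (hx : x ∈ G) : act x u = u ∨ act x u = -u := by
  have hpow : ∀ n : ℕ, act (g ^ n) u = u := fun n ↦ by
    induction n with
    | zero => rw [pow_zero, one_act]
    | succ n ih => rw [pow_succ, mul_act, hgu, ih]
  -- `k` commutes with `g ^ 2`, so it preserves the axis of `g` up to sign, and `k ^ 2` fixes `u`.
  -- Since `k ^ 2` also fixes `act x u` and is not 1, the two vectors are parallel.
  set k := (x * g * x⁻¹) ^ 2 with hk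
  have hkc : Commute k (g ^ 2) :=
    hcomm _ (G.mul_mem (G.mul_mem hx hgG) (G.inv_mem hx)) _ hgG
  obtain ⟨r, hr⟩ := exists_smul_eq_of_act_eq hu (not_isOfFinOrder_pow hg two_ne_zero) (hpow 2)
    (v := act k u) (by rw [← mul_act, ← hkc.eq, mul_act, hpow])
  have hk2u : act (k ^ 2) u = u := by
    rcases act_eq_or_eq_neg hu hr with h | h
    · rw [pow_two, mul_act, h, h]
    · rw [pow_two, mul_act, h, act_neg, h, neg_neg]
  have hk2 : k ^ 2 = x * g ^ 4 * x⁻¹ := by rw [hk, conj_pow, conj_pow, ← pow_mul]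
  have hk2ne : k ^ 2 ≠ 1 := by
    rw [hk2, Ne, conj_eq_one_iff]
    exact not_isOfFinOrder_pow hg four_ne_zero
  obtain ⟨s, hs⟩ := exists_smul_eq_of_act_eq hu hk2ne hk2u (v := act x u) (by
    rw [hk2, ← mul_act, inv_mul_cancel_right, mul_act, hpow])
  exact act_eq_or_eq_neg hu hs

theorem exists_pair_or_preserves_line {H : Subgroup SO3} {g : SO3} (hgH : g ∈ H)
    (hg : ¬ IsOfFinOrder g) {u : Fin 3 → ℝ} (hu : u ≠ 0) (hgu : act g u = u) :
    (∃ C : Fin 2 → SO3, (∀ k, C k ∈ H) ∧ ConditionA C ∧ ConditionB C ∧ ConditionC C) ∨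
      ∀ h ∈ H, act h u = u ∨ act h u = -u := by
  by_contra! hcon
  obtain ⟨hno, h, hh, hne⟩ := hcon
  have hconj : ∀ n ≠ 0, (h * g * h⁻¹) ^ n ≠ 1 := fun n hn ↦ by
    rw [conj_pow, Ne, conj_eq_one_iff]
    exact not_isOfFinOrder_pow hg hn
  have hg1 : g ≠ 1 := by simpa using not_isOfFinOrder_pow hg one_ne_zero
  have hconj1 : h * g * h⁻¹ ≠ 1 := by simpa using hconj 1 one_ne_zero
  refine hno ![g, h * g * h⁻¹] ?_ ?_ ?_ ?_
  · intro k
    fin_cases k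
    · exact hgH
    · exact H.mul_mem (H.mul_mem hh hgH) (H.inv_mem hh)
  · intro k
    fin_cases k
    · exact not_isOfFinOrder_pow hg two_ne_zero
    · exact hconj 2 two_ne_zero
  · intro a b ha hb
    obtain ⟨ha1, ha0⟩ := isAxisVector_iff.mp ha
    obtain ⟨hb1, hb0⟩ := isAxisVector_iff.mp hb
    obtain ⟨r, hr⟩ := exists_smul_eq_of_act_eq ha0 hg1 ha1 hgu
    -- The conjugate by `h` has the axis of `act h u`; dependent eigenvectors would thus make `act h
    -- u` parallel to `u`, hence equal to `u` or `-u`.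
    obtain ⟨s, hs⟩ := exists_smul_eq_of_act_eq hb0 hconj1 hb1 (v := act h u) (by
      rw [← mul_act, inv_mul_cancel_right, mul_act, hgu])
    have hr0 : r ≠ 0 := fun h0 ↦ hu (by rw [hr, h0, zero_smul])
    have hne0 : a ≠ 0 := fun h ↦ ha0 (by rw [h]; rfl)
    rw [LinearIndependent.pair_iff' hne0]
    intro t ht
    have hb : b.ofLp = t • a.ofLp := by rw [← ht]; rfl
    have hpar : act h u = (s * t / r) • u := by
      rw [hs, hb, hr, smul_smul, smul_smul, div_mul_cancel₀ _ hr0]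
    rcases act_eq_or_eq_neg hu hpar with h' | h'
    exacts [hne.1 h', hne.2 h']
  · obtain ⟨ζ, ψ, hζ⟩ := exists_hasEigenvalue_irrational hg
    exact ⟨0, ζ, ψ, hζ⟩

end TopHolonomy

end

/-! ### The proposition -/

theorem proposition3p4 {E : TopHolonomy.Torus → Type*}
    [TopologicalSpace (TotalSpace TopHolonomy.R4 E)]
    [∀ x, NormedAddCommGroup (E x)] [∀ x, InnerProductSpace ℝ (E x)]
    [FiberBundle TopHolonomy.R4 E] [VectorBundle ℝ TopHolonomy.R4 E]
    [ContMDiffVectorBundle ∞ TopHolonomy.R4 E TopHolonomy.torusModel]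
    [IsContMDiffRiemannianBundle TopHolonomy.torusModel ∞ TopHolonomy.R4 E]
    (o : ∀ x, Orientation ℝ (E x) (Fin 4)) (ho : TopHolonomy.IsBundleOrientation o)
    (cov : CovariantDerivative TopHolonomy.torusModel TopHolonomy.R4 E)
    (hsmooth : CovariantDerivative.ContMDiffCovariantDerivative cov ∞)
    (hcov : cov.IsMetricCompatible)
    (ε : ℤˣ)
    (H : Subgroup TopHolonomy.SO3) (hH : TopHolonomy.IsTopologicalHolonomyGroup cov o ε H)
    (G : Subgroup TopHolonomy.SO3) (hG : TopHolonomy.IsHalvedAngleGroup G)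
    (hiso : Nonempty (H ≃* G))
    (hinf : TopHolonomy.HasInfiniteComplexity cov o ε) :
    ∃ C : Fin 2 → TopHolonomy.SO3, (∀ k, C k ∈ H) ∧
      TopHolonomy.ConditionA C ∧ TopHolonomy.ConditionB C ∧ TopHolonomy.ConditionC C := by
  open TopHolonomy in
  obtain ⟨-, -, -, C₁, C₂, -, -, -, -, -, hHC⟩ := id hH
  have hHinf : Infinite H := hH.infinite hcov hinf
  obtain ⟨g, hgH, hg⟩ : ∃ g ∈ H, ¬ IsOfFinOrder g := by
    rw [hHC] at hHinf ⊢
    exact exists_not_isOfFinOrder (Set.toFinite _) hHinf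
  obtain ⟨u, hu, hgu⟩ := SO3.exists_act_eq g
  refine (exists_pair_or_preserves_line hgH hg hu hgu).resolve_right fun hline ↦ ?_
  obtain ⟨f⟩ := hiso
  have hsq : ∀ x : H, SO3.act ((x : SO3) ^ 2) u = u := fun x ↦ by
    rcases hline x x.2 with h | h
    · rw [pow_two, SO3.mul_act, h, h]
    · rw [pow_two, SO3.mul_act, h, SO3.act_neg, h, neg_neg]
  -- Squares fix `u`, so they are rotations about one axis; their commuting is the trace of the
  -- invariant line that the abstract isomorphism carries to `G`.
  have hcommH : ∀ x y : H, Commute (x ^ 2) (y ^ 2) := fun x y ↦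
    Subtype.ext (SO3.commute_of_act_eq hu (hsq x) (hsq y))
  have hcommG : ∀ x ∈ G, ∀ y ∈ G, Commute (x ^ 2) (y ^ 2) := fun x hx y hy ↦ by
    have h := (hcommH (f.symm ⟨x, hx⟩) (f.symm ⟨y, hy⟩)).map f
    rw [map_pow, map_pow, f.apply_symm_apply, f.apply_symm_apply] at h
    exact congrArg Subtype.val h
  have hg' : ¬ IsOfFinOrder ((f ⟨g, hgH⟩ : G) : SO3) := fun h ↦ by
    have h1 : IsOfFinOrder (f ⟨g, hgH⟩) := Submonoid.isOfFinOrder_coe.mp h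
    exact hg (Submonoid.isOfFinOrder_coe.mpr (by
      simpa using f.symm.toMonoidHom.isOfFinOrder h1))
  obtain ⟨v, hv, hgv⟩ := SO3.exists_act_eq (f ⟨g, hgH⟩ : G)
  exact hg' (hG.isOfFinOrder_of_preserves_line hv
    (fun x hx ↦ act_eq_or_eq_neg_of_commute_sq hcommG (f ⟨g, hgH⟩).2 hg' hv hgv hx) _
    (f ⟨g, hgH⟩).2)
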